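/- Let $K$ be a field of characteristic zero, let $\kappa_1,\kappa_2\in K$, and put $\Lambda_l=1/(1-\kappa_l^2)$ for $l=1,2$, where $\Lambda_1,\Lambda_2\notin\{0,1,\infty\}$. Let $\rho_1,\rho_2\in K$ satisfy $$\rho_1=\Lambda_1+\Lambda_2-2\Lambda_1\Lambda_2-1,\qquad \rho_2^2=(1-\Lambda_1-\Lambda_2)^2 .$$ Let $\mathcal E_l$ be the elliptic curve $y^2=x(x-1)(x-\Lambda_l)$ and $\mathcal E_l'$ the two-isogenous elliptic curve $y^2=x\bigl(x^2+2(1-2\Lambda_l)x+1\bigr)$. Consider the following surfaces over $K$, each equipped with a holomorphic two-form. * $\mathcal X$ is the minimal resolution of the double sextic surface (the twisted Legendre pencil) $y^2=z_1z_2(z_1-z_2)(z_1-z_3)(z_3^2+2\rho_1z_2z_3+\rho_2^2z_2^2)$ in $\mathbb P(1,1,1,3)$, with $\omega_{\mathcal X}=dz_1\wedge dz_3/y$ in the chart $z_2=1$. * $\operatorname{Kum}(\mathcal E_1\times\mathcal E_2)^{(\varepsilon)}$, for $\varepsilon\in\{1,2^4\}$, is the minimal resolution of the double cover $y^2=\varepsilon\,x_1z_1(x_1-z_1)(x_1-\Lambda_1z_1)\,x_2z_2(x_2-z_2)(x_2-\Lambda_2z_2)$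 of $\mathbb P^1\times\mathbb P^1$, with two-form $dx_1\wedge dx_2/y$ in the chart $z_1=z_2=1$; for $\varepsilon=1$ it is denoted by $\operatorname{Kum}(\mathcal E_1\times\mathcal E_2)$. * $\operatorname{Kum}(\mathcal E_1'\times\mathcal E_2')$ is the minimal resolution of the double cover $y^2=x_1z_1\bigl(x_1^2+2(1-2\Lambda_1)x_1z_1+z_1^2\bigr)\,x_2z_2\bigl(x_2^2+2(1-2\Lambda_2)x_2z_2+z_2^2\bigr)$ of $\mathbb P^1\times\mathbb P^1$, with two-form $dx_1\wedge dx_2/y$ in the chart $z_1=z_2=1$. Then there are dominant rational maps over $K$ $$\operatorname{Kum}(\mathcal E_1\times\mathcal E_2)\ \overset{f_1}{\dashrightarrow}\ \mathcal X\ \overset{f_2}{\dashrightarrow}\ \operatorname{Kum}(\mathcal E_1'\times\mathcal E_2')\ \overset{f_3}{\dashrightarrow}\ \operatorname{Kum}(\mathcal E_1\times\mathcal E_2)^{(2^4)}$$ with $$f_1^*\,\omega_{\mathcal X}=\omega_{\operatorname{Kum}(\mathcal E_1\times\mathcal E_2)},\qquad f_2^*\,\omega_{\operatorname{Kum}(\mathcal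 E_1'\times\mathcal E_2')}=\omega_{\mathcal X},\qquad f_3^*\,\omega_{\operatorname{Kum}(\mathcal E_1\times\mathcal E_2)^{(2^4)}}=\omega_{\operatorname{Kum}(\mathcal E_1'\times\mathcal E_2')} .$$ Moreover the maps are defined on families over $\mathbb Q(\kappa_1,\kappa_2)$: in the affine coordinates of the charts above, $f_1,f_2,f_3$ are given by quotients of polynomials with rational coefficients in $\kappa_1,\kappa_2$ and the affine coordinates of the source; these polynomials do not depend on $K,\kappa_1,\kappa_2,\rho_1,\rho_2$, and the denominators do not vanish identically on any member of the family. -/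

import Mathlib

open AlgebraicGeometry CategoryTheory MvPolynomial
open scoped DirectSum KaehlerDifferential

universe u

namespace KummerSandwich

noncomputable section

/-! ### Closed subschemes of weighted projective spaces -/

section Grading

variable {K : Type u} [Field K] {A : Type u} [CommRing A] [Algebra K A]
  (𝒜 : ℕ → Submodule K A) [GradedAlgebra 𝒜] (I : HomogeneousIdeal 𝒜)

/-- The grading induced on the quotient of a graded ring by a homogeneous ideal. -/
def quotGrading (n : ℕ) : Submodule K (A ⧸ I.toIdeal) :=
  (𝒜 n).map (Ideal.Quotient.mkₐ K I.toIdeal).toLinearMap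

lemma mk_mem_quotGrading {n : ℕ} {a : A} (ha : a ∈ 𝒜 n) :
    Ideal.Quotient.mk I.toIdeal a ∈ quotGrading 𝒜 I n :=
  ⟨a, ha, rfl⟩

instance quotGrading.gradedMonoid : SetLike.GradedMonoid (quotGrading 𝒜 I) where
  one_mem := ⟨1, SetLike.GradedOne.one_mem, map_one (Ideal.Quotient.mk I.toIdeal)⟩
  mul_mem := by
    rintro i j _ _ ⟨a, ha, rfl⟩ ⟨b, hb, rfl⟩
    exact ⟨a * b, SetLike.GradedMul.mul_mem ha hb, map_mul (Ideal.Quotient.mk I.toIdeal) a b⟩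

/-- The quotient map in degree `n`. -/
def quotMap (n : ℕ) : 𝒜 n →+ quotGrading 𝒜 I n where
  toFun a := ⟨Ideal.Quotient.mk I.toIdeal a, mk_mem_quotGrading 𝒜 I a.2⟩
  map_zero' := Subtype.ext (by simp)
  map_add' a b := Subtype.ext (by simp)

lemma coe_map_quotMap (y : ⨁ n, 𝒜 n) :
    DirectSum.coeAddMonoidHom (quotGrading 𝒜 I) (DirectSum.map (quotMap 𝒜 I) y) =
      Ideal.Quotient.mk I.toIdeal (DirectSum.coeAddMonoidHom 𝒜 y) := by
  induction y using DirectSum.induction_on with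
  | zero => simp
  | of n a => simp [quotMap]
  | add x y hx hy => simp only [map_add, hx, hy]

lemma quotGrading_isInternal : DirectSum.IsInternal (quotGrading 𝒜 I) := by
  constructor
  · rw [injective_iff_map_eq_zero]
    intro x hx
    have hs : Function.Surjective (DirectSum.map (quotMap 𝒜 I)) := by
      rw [DirectSum.map_surjective]
      rintro n ⟨_, a, ha, rfl⟩
      exact ⟨⟨a, ha⟩, rfl⟩
    obtain ⟨y, rfl⟩ := hs x
    rw [coe_map_quotMap, Ideal.Quotient.eq_zero_iff_mem] at hx
    refine DFinsupp.ext fun n => Subtype.ext ?_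
    have h := I.isHomogeneous n hx
    have e : DirectSum.decompose 𝒜 (DirectSum.coeAddMonoidHom 𝒜 y) = y :=
      (DirectSum.decompose 𝒜).apply_symm_apply y
    rw [e] at h
    exact Ideal.Quotient.eq_zero_iff_mem.2 h
  · intro x
    obtain ⟨a, rfl⟩ := Ideal.Quotient.mk_surjective x
    refine ⟨DirectSum.map (quotMap 𝒜 I) (DirectSum.decompose 𝒜 a), ?_⟩
    rw [coe_map_quotMap]
    congr 1
    exact (DirectSum.decompose 𝒜).symm_apply_apply a

instance quotGrading.gradedAlgebra : GradedAlgebra (quotGrading 𝒜 I) where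
  toDecomposition := (quotGrading_isInternal 𝒜 I).chooseDecomposition

end Grading

section WeightedProjective

variable {K : Type u} [Field K] {m : ℕ} (w : Fin m → ℕ)

instance weightedGrading : GradedAlgebra (weightedHomogeneousSubmodule K w) :=
  weightedGradedAlgebra K w

/-- The homogeneous ideal generated by a set of weighted homogeneous polynomials. -/
def idealOf (s : Set (MvPolynomial (Fin m) K)) (hs : ∀ p ∈ s, ∃ n, IsWeightedHomogeneous w p n) :
    HomogeneousIdeal (weightedHomogeneousSubmodule K w) :=
  ⟨Ideal.span s, Ideal.homogeneous_span _ s fun p hp => hs p hp⟩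

variable {w} (I : HomogeneousIdeal (weightedHomogeneousSubmodule K w))

/-- The homogeneous coordinate ring `K[X₀, …, Xₘ₋₁] / I`, graded by the weights. -/
abbrev coordGrading : ℕ → Submodule K (MvPolynomial (Fin m) K ⧸ I.toIdeal) :=
  quotGrading (weightedHomogeneousSubmodule K w) I

/-- The closed subscheme `V₊(I)` of the weighted projective space with weights `w`. -/
def wproj : Scheme.{u} :=
  Proj (coordGrading I)

/-- The structure morphism of `V₊(I)`. -/
def wprojToSpec : wproj I ⟶ Spec (.of K) :=
  Proj.toSpecZero (coordGrading I) ≫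
    Spec.map (CommRingCat.ofHom (algebraMap K (coordGrading I 0)))

lemma var_mem (j : Fin m) :
    Ideal.Quotient.mk I.toIdeal (X j) ∈ coordGrading I (w j) :=
  mk_mem_quotGrading _ _ (isWeightedHomogeneous_X K w j)

/-- The affine coordinate function `Xⱼ / X_c ^ (w j)` on the chart `X_c ≠ 0`, where `X_c` is a
variable of weight one. -/
def affineCoord (c : Fin m) (hc : w c = 1) (j : Fin m) :
    HomogeneousLocalization.Away (coordGrading I) (Ideal.Quotient.mk I.toIdeal (X c)) :=
  HomogeneousLocalization.Away.mk (coordGrading I) (var_mem I c) (w j)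
    (Ideal.Quotient.mk I.toIdeal (X j))
    (by simpa [hc] using var_mem I j)

end WeightedProjective

/-! ### Resolutions, function fields, two-forms, rational maps -/

section Resolutions

variable {K : Type u} [Field K]

/-- A resolution of singularities of a `K`-scheme `Z` (for `K` of characteristic zero): a proper
morphism `g : S ⟶ Z` from an integral smooth `K`-scheme that is an isomorphism over a dense
open subset of `Z` with dense preimage. -/
structure IsResolution {S Z : Scheme.{u}} (z : Z ⟶ Spec (.of K)) (g : S ⟶ Z) : Prop where
  isIntegral : IsIntegral S
  smooth : Smooth (g ≫ z)
  proper : IsProper g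
  birational : ∃ U : Z.Opens, Dense (U : Set Z) ∧ Dense ((g ⁻¹ᵁ U : S.Opens) : Set S) ∧
    IsIso (g ∣_ U)

/-- A minimal resolution of a surface: every other resolution factors through it. -/
structure MinimalResolution {Z : Scheme.{u}} (z : Z ⟶ Spec (.of K)) where
  surface : Scheme.{u}
  map : surface ⟶ Z
  isResolution : IsResolution z map
  minimal : ∀ (T : Scheme.{u}) (g : T ⟶ Z), IsResolution z g → ∃ h : T ⟶ surface, h ≫ map = g

variable {Z Z' : Scheme.{u}} {z : Z ⟶ Spec (.of K)} {z' : Z' ⟶ Spec (.of K)}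

instance MinimalResolution.isIntegral (S : MinimalResolution z) : IsIntegral S.surface :=
  S.isResolution.isIntegral

/-- The structure morphism of the resolved surface. -/
def MinimalResolution.toSpec (S : MinimalResolution z) : S.surface ⟶ Spec (.of K) :=
  S.map ≫ z

/-- The function field `K(S)`. -/
abbrev MinimalResolution.FunctionField (S : MinimalResolution z) : Type u :=
  S.surface.functionField

/-- The generic point `Spec K(S) ⟶ S`. -/
def MinimalResolution.generic (S : MinimalResolution z) :
    Spec (.of S.FunctionField) ⟶ S.surface :=
  S.surface.fromSpecStalk (genericPoint S.surface)

/-- The constants `K ⊆ K(S)`. -/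
instance MinimalResolution.algebra (S : MinimalResolution z) : Algebra K S.FunctionField :=
  (Spec.preimage (S.generic ≫ S.toSpec)).hom.toAlgebra

/-- Rational two-forms of a function field `F` over `K`. -/
abbrev TwoForm (K F : Type u) [Field K] [Field F] [Algebra K F] : Type u :=
  ⋀[F]^2 Ω[F⁄K]

/-- The two-form `dx ∧ dy / t`. -/
def natForm (K : Type u) {F : Type u} [Field K] [Field F] [Algebra K F] (x y t : F) :
    TwoForm K F :=
  t⁻¹ • exteriorPower.ιMulti F 2 ![KaehlerDifferential.D K F x, KaehlerDifferential.D K F y]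

/-- Pullback of two-forms along a homomorphism of function fields; it is the additive map with
`a • (dx ∧ dy) ↦ φ a • (d(φ x) ∧ d(φ y))`. -/
def pullbackTwoForm {F L : Type u} [Field F] [Field L] [Algebra K F] [Algebra K L]
    (φ : F →ₐ[K] L) : TwoForm K F →+ TwoForm K L :=
  letI : Algebra F L := φ.toRingHom.toAlgebra
  haveI : IsScalarTower K F L := IsScalarTower.of_algebraMap_eq fun k => (φ.commutes k).symm
  (exteriorPower.alternatingMapLinearEquiv
    { toMultilinearMap := ((exteriorPower.ιMulti L 2 (M := Ω[L⁄K])).toMultilinearMap.restrictScalars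
        F).compLinearMap fun _ => KaehlerDifferential.map K K F L
      map_eq_zero_of_eq' := fun _ _ _ h hij =>
        (exteriorPower.ιMulti L 2).map_eq_zero_of_eq _
          (congrArg (KaehlerDifferential.map K K F L) h) hij }).toAddMonoidHom

lemma pullbackTwoForm_smul_ι {F L : Type u} [Field F] [Field L] [Algebra K F] [Algebra K L]
    (φ : F →ₐ[K] L) (a x y : F) :
    pullbackTwoForm φ (a • exteriorPower.ιMulti F 2
        ![KaehlerDifferential.D K F x, KaehlerDifferential.D K F y]) =
      φ a • exteriorPower.ιMulti L 2
        ![KaehlerDifferential.D K L (φ x), KaehlerDifferential.D K L (φ y)] := by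
  let : Algebra F L := φ.toRingHom.toAlgebra
  have : IsScalarTower K F L := IsScalarTower.of_algebraMap_eq fun k => (φ.commutes k).symm
  refine ((exteriorPower.alternatingMapLinearEquiv _).map_smul a _).trans ?_
  rw [exteriorPower.alternatingMapLinearEquiv_apply_ιMulti, ← algebraMap_smul L]
  change φ a • exteriorPower.ιMulti L 2 _ = _
  congr 2
  ext i
  fin_cases i <;> exact KaehlerDifferential.map_D K K F L _

/-- A dominant rational map `S ⤏ T` over `K`, together with the (uniquely determined) homomorphism
`K(T) → K(S)` of function fields by which it acts on the generic points. -/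
structure DominantMap (S : MinimalResolution z) (T : MinimalResolution z') where
  toRationalMap : S.surface ⤏ T.surface
  isOver : toRationalMap.compHom T.toSpec = S.toSpec.toRationalMap
  isDominant : toRationalMap.IsDominant
  comap : T.FunctionField →ₐ[K] S.FunctionField
  comap_spec : Spec.map (CommRingCat.ofHom comap.toRingHom) ≫ T.generic =
    toRationalMap.fromFunctionField

/-- The pullback `f^*` of rational two-forms. -/
def DominantMap.pullback {S : MinimalResolution z} {T : MinimalResolution z'}
    (f : DominantMap S T) : TwoForm K T.FunctionField →+ TwoForm K S.FunctionField :=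
  pullbackTwoForm f.comap

/-- The value in `F` of a polynomial over `ℚ` in `κ₁, κ₂` and three further variables. -/
def evalFamily {F : Type u} [Field F] [Algebra K F] [CharZero K] (κ₁ κ₂ : K) (x : Fin 3 → F)
    (P : MvPolynomial (Fin 5) ℚ) : F :=
  P.eval₂ ((algebraMap K F).comp (algebraMap ℚ K))
    ![algebraMap K F κ₁, algebraMap K F κ₂, x 0, x 1, x 2]

/-- In terms of coordinate functions `x` on `S` and `t` on `T`, the rational map `f` is given by
`tᵢ = Nᵢ(κ₁, κ₂, x) / Dᵢ(κ₁, κ₂, x)`. -/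
def DominantMap.GivenBy [CharZero K] {S : MinimalResolution z} {T : MinimalResolution z'}
    (f : DominantMap S T) (κ₁ κ₂ : K) (x : Fin 3 → S.FunctionField) (t : Fin 3 → T.FunctionField)
    (N D : Fin 3 → MvPolynomial (Fin 5) ℚ) : Prop :=
  ∀ i, evalFamily κ₁ κ₂ x (D i) ≠ 0 ∧
    f.comap (t i) = evalFamily κ₁ κ₂ x (N i) / evalFamily κ₁ κ₂ x (D i)

open Classical in
/-- The rational function `Xⱼ / X_c ^ (w j)` on `V₊(I)`, pulled back to a resolution `S`.
(The chart `X_c ≠ 0` has a nonempty preimage whenever it is dense in `V₊(I)`.) -/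
def MinimalResolution.coord {m : ℕ} {w : Fin m → ℕ}
    {I : HomogeneousIdeal (weightedHomogeneousSubmodule K w)}
    (S : MinimalResolution (wprojToSpec I)) (c : Fin m) (hc : w c = 1) (j : Fin m) :
    S.FunctionField :=
  let U : (wproj I).Opens := Proj.basicOpen (coordGrading I) (Ideal.Quotient.mk I.toIdeal (X c))
  if _ : Nonempty (S.map ⁻¹ᵁ U) then
    (S.surface.germToFunctionField (S.map ⁻¹ᵁ U)).hom
      ((S.map.app U).hom ((Proj.awayToSection (coordGrading I) _).hom (affineCoord I c hc j)))
  else 0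

end Resolutions

/-! ### The surfaces -/

section Surfaces

variable {K : Type u} [Field K]

/-- The elliptic curve `y² = x (x - 1) (x - Λ)`. -/
def legendreCurve (Λ : K) : WeierstrassCurve K :=
  ⟨0, -(1 + Λ), 0, Λ, 0⟩

/-- The elliptic curve `y² = x (x² + 2 (1 - 2 Λ) x + 1)`, the quotient of `y² = x (x - 1) (x - Λ)`
by the subgroup generated by the point `(Λ, 0)`. -/
def isogenousCurve (Λ : K) : WeierstrassCurve K :=
  ⟨0, 2 * (1 - 2 * Λ), 0, 1, 0⟩

lemma legendreCurve_equation (Λ x y : K) :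
    (legendreCurve Λ).toAffine.Equation x y ↔ y ^ 2 = x * (x - 1) * (x - Λ) := by
  rw [WeierstrassCurve.Affine.equation_iff]
  simp only [legendreCurve]
  constructor <;> intro h <;> linear_combination h

/-- The two-isogeny with kernel generated by `(Λ, 0)`, on affine points. -/
lemma isogenousCurve_equation {Λ x y : K} (h : (legendreCurve Λ).toAffine.Equation x y)
    (hx : x ≠ Λ) :
    (isogenousCurve Λ).toAffine.Equation (y ^ 2 / (x - Λ) ^ 2)
      (y * ((x - Λ) ^ 2 - Λ * (Λ - 1)) / (x - Λ) ^ 2) := by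
  rw [legendreCurve_equation] at h
  rw [WeierstrassCurve.Affine.equation_iff]
  simp only [isogenousCurve]
  have hx' : x - Λ ≠ 0 := sub_ne_zero.2 hx
  field_simp
  have e : y ^ 4 + y ^ 2 * (2 * (1 - 2 * Λ)) * (x - Λ) ^ 2 + (x - Λ) ^ 4 =
      ((x - Λ) ^ 2 - Λ * (Λ - 1)) ^ 2 * (x - Λ) ^ 2 := by
    have h4 : y ^ 4 = (x * (x - 1) * (x - Λ)) ^ 2 := by rw [← h]; ring
    rw [h4, h]
    ring
  linear_combination -y ^ 2 * e

/-- In the Segre coordinates `X₀ = x₁x₂, X₁ = x₁z₂, X₂ = z₁x₂, X₃ = z₁z₂` of `ℙ¹ × ℙ¹`, the form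
`x₁z₁(x₁² + a x₁z₁ + b z₁²) x₂z₂(x₂² + a' x₂z₂ + b' z₂²)` of bidegree `(4, 4)` attached to the curves
`E₁ : y² = x(x² + a x + b)` and `E₂ : y² = x(x² + a' x + b')`. -/
def branchForm (E₁ E₂ : WeierstrassCurve K) : MvPolynomial (Fin 5) K :=
  X 0 * X 3 *
    (X 0 ^ 2 + C E₂.a₂ * (X 0 * X 1) + C E₂.a₄ * X 1 ^ 2 +
      C E₁.a₂ * (X 0 * X 2) + C (E₁.a₂ * E₂.a₂) * (X 0 * X 3) + C (E₁.a₂ * E₂.a₄) * (X 1 * X 3) +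
      C E₁.a₄ * X 2 ^ 2 + C (E₁.a₄ * E₂.a₂) * (X 2 * X 3) + C (E₁.a₄ * E₂.a₄) * X 3 ^ 2)

lemma eval_branchForm (E₁ E₂ : WeierstrassCurve K) (x₁ z₁ x₂ z₂ y : K) :
    eval ![x₁ * x₂, x₁ * z₂, z₁ * x₂, z₁ * z₂, y] (branchForm E₁ E₂) =
      x₁ * z₁ * (x₁ ^ 2 + E₁.a₂ * x₁ * z₁ + E₁.a₄ * z₁ ^ 2) *
        (x₂ * z₂ * (x₂ ^ 2 + E₂.a₂ * x₂ * z₂ + E₂.a₄ * z₂ ^ 2)) := by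
  simp [branchForm]
  ring

lemma eval_branchForm_legendre (Λ₁ Λ₂ x₁ z₁ x₂ z₂ y : K) :
    eval ![x₁ * x₂, x₁ * z₂, z₁ * x₂, z₁ * z₂, y]
        (branchForm (legendreCurve Λ₁) (legendreCurve Λ₂)) =
      x₁ * z₁ * (x₁ - z₁) * (x₁ - Λ₁ * z₁) * (x₂ * z₂ * (x₂ - z₂) * (x₂ - Λ₂ * z₂)) := by
  rw [eval_branchForm]
  simp only [legendreCurve]
  ring

lemma eval_branchForm_isogenous (Λ₁ Λ₂ x₁ z₁ x₂ z₂ y : K) :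
    eval ![x₁ * x₂, x₁ * z₂, z₁ * x₂, z₁ * z₂, y]
        (branchForm (isogenousCurve Λ₁) (isogenousCurve Λ₂)) =
      x₁ * z₁ * (x₁ ^ 2 + 2 * (1 - 2 * Λ₁) * x₁ * z₁ + z₁ ^ 2) *
        (x₂ * z₂ * (x₂ ^ 2 + 2 * (1 - 2 * Λ₂) * x₂ * z₂ + z₂ ^ 2)) := by
  rw [eval_branchForm]
  simp only [isogenousCurve]
  ring

/-- Weights of `ℙ(1, 1, 1, 1, 2)`, with coordinates `x₁x₂, x₁z₂, z₁x₂, z₁z₂, y`. -/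
abbrev quadricWeight : Fin 5 → ℕ := ![1, 1, 1, 1, 2]

/-- Weights of `ℙ(1, 1, 1, 3)`, with coordinates `z₁, z₂, z₃, y`. -/
abbrev sexticWeight : Fin 4 → ℕ := ![1, 1, 1, 3]

lemma isWeightedHomogeneous_C_mul {m : ℕ} {w : Fin m → ℕ} (a : K) {p : MvPolynomial (Fin m) K}
    {n : ℕ} (hp : IsWeightedHomogeneous w p n) : IsWeightedHomogeneous w (C a * p) n := by
  simpa using (isWeightedHomogeneous_C w a).mul hp

lemma branchForm_homogeneous (E₁ E₂ : WeierstrassCurve K) :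
    IsWeightedHomogeneous quadricWeight (branchForm E₁ E₂) 4 := by
  have h : ∀ i : Fin 5, IsWeightedHomogeneous quadricWeight (X i : MvPolynomial (Fin 5) K)
      (quadricWeight i) := isWeightedHomogeneous_X K _
  have hm : ∀ i j : Fin 5, quadricWeight i = 1 → quadricWeight j = 1 →
      IsWeightedHomogeneous quadricWeight (X i * X j : MvPolynomial (Fin 5) K) 2 := by
    intro i j hi hj
    simpa [hi, hj] using (h i).mul (h j)
  have hq : ∀ i : Fin 5, quadricWeight i = 1 →
      IsWeightedHomogeneous quadricWeight (X i ^ 2 : MvPolynomial (Fin 5) K) 2 := by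
    intro i hi
    simpa [sq] using hm i i hi hi
  refine (hm 0 3 rfl rfl).mul (n := 2) ?_
  refine IsWeightedHomogeneous.add ?_ (isWeightedHomogeneous_C_mul _ (hq 3 rfl))
  refine IsWeightedHomogeneous.add ?_ (isWeightedHomogeneous_C_mul _ (hm 2 3 rfl rfl))
  refine IsWeightedHomogeneous.add ?_ (isWeightedHomogeneous_C_mul _ (hq 2 rfl))
  refine IsWeightedHomogeneous.add ?_ (isWeightedHomogeneous_C_mul _ (hm 1 3 rfl rfl))
  refine IsWeightedHomogeneous.add ?_ (isWeightedHomogeneous_C_mul _ (hm 0 3 rfl rfl))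
  refine IsWeightedHomogeneous.add ?_ (isWeightedHomogeneous_C_mul _ (hm 0 2 rfl rfl))
  refine IsWeightedHomogeneous.add ?_ (isWeightedHomogeneous_C_mul _ (hq 1 rfl))
  exact (hq 0 rfl).add (isWeightedHomogeneous_C_mul _ (hm 0 1 rfl rfl))

lemma isWeightedHomogeneous_sub {m : ℕ} {w : Fin m → ℕ} {p q : MvPolynomial (Fin m) K}
    {n : ℕ} (hp : IsWeightedHomogeneous w p n) (hq : IsWeightedHomogeneous w q n) :
    IsWeightedHomogeneous w (p - q) n :=
  (weightedHomogeneousSubmodule K w n).sub_mem hp hq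

/-- The homogeneous ideal of the double quadric surface. -/
def doubleQuadricIdeal (E₁ E₂ : WeierstrassCurve K) (ε : K) :
    HomogeneousIdeal (weightedHomogeneousSubmodule K quadricWeight) :=
  idealOf quadricWeight {X 0 * X 3 - X 1 * X 2, X 4 ^ 2 - C ε * branchForm E₁ E₂} (by
    have h : ∀ i : Fin 5, IsWeightedHomogeneous quadricWeight (X i : MvPolynomial (Fin 5) K)
      (quadricWeight i) := isWeightedHomogeneous_X K _
    rintro p (rfl | rfl)
    · exact ⟨2, isWeightedHomogeneous_sub ((h 0).mul (h 3)) ((h 1).mul (h 2))⟩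
    · exact ⟨4, isWeightedHomogeneous_sub ((h 4).pow 2)
        (isWeightedHomogeneous_C_mul _ (branchForm_homogeneous E₁ E₂))⟩)

/-- The double cover `y² = ε x₁z₁(x₁² + a x₁z₁ + b z₁²) x₂z₂(x₂² + a' x₂z₂ + b' z₂²)` of `ℙ¹ × ℙ¹`, a
model of the quotient of `E₁ × E₂` by `-1`, twisted by `ε`, for elliptic curves
`E₁ : y² = x(x² + a x + b)` and `E₂ : y² = x(x² + a' x + b')`. -/
abbrev doubleQuadric (E₁ E₂ : WeierstrassCurve K) (ε : K) :
    wproj (doubleQuadricIdeal E₁ E₂ ε) ⟶ Spec (.of K) :=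
  wprojToSpec (doubleQuadricIdeal E₁ E₂ ε)

/-- The Kummer surface `Kum(E₁ × E₂)^(ε)`: the minimal resolution of the double quadric. -/
abbrev Kum (E₁ E₂ : WeierstrassCurve K) (ε : K) :=
  MinimalResolution (doubleQuadric E₁ E₂ ε)

/-- The coordinate functions `x₁, x₂, y` of the chart `z₁ = z₂ = 1`. -/
def Kum.coords {E₁ E₂ : WeierstrassCurve K} {ε : K} (S : Kum E₁ E₂ ε) :
    Fin 3 → S.FunctionField :=
  ![S.coord 3 rfl 1, S.coord 3 rfl 2, S.coord 3 rfl 4]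

/-- The two-form `dx₁ ∧ dx₂ / y`. -/
def Kum.form {E₁ E₂ : WeierstrassCurve K} {ε : K} (S : Kum E₁ E₂ ε) :
    TwoForm K S.FunctionField :=
  natForm K (Kum.coords S 0) (Kum.coords S 1) (Kum.coords S 2)

/-- The homogeneous ideal of the twisted Legendre pencil. -/
def legendrePencilIdeal (ρ₁ ρ₂ : K) :
    HomogeneousIdeal (weightedHomogeneousSubmodule K sexticWeight) :=
  idealOf sexticWeight {X 3 ^ 2 - X 0 * X 1 * (X 0 - X 1) * (X 0 - X 2) *
      (X 2 ^ 2 + C (2 * ρ₁) * (X 1 * X 2) + C (ρ₂ ^ 2) * X 1 ^ 2)} (by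
    have h : ∀ i : Fin 4, IsWeightedHomogeneous sexticWeight (X i : MvPolynomial (Fin 4) K)
      (sexticWeight i) := isWeightedHomogeneous_X K _
    rintro p rfl
    refine ⟨6, isWeightedHomogeneous_sub ((h 3).pow 2) ?_⟩
    refine ((((h 0).mul (h 1)).mul (isWeightedHomogeneous_sub (h 0) (h 1))).mul
      (isWeightedHomogeneous_sub (h 0) (h 2))).mul (n := 2) ?_
    exact (((h 2).pow 2).add (isWeightedHomogeneous_C_mul _ ((h 1).mul (h 2)))).add
      (isWeightedHomogeneous_C_mul _ ((h 1).pow 2)))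

/-- The double sextic `y² = z₁z₂(z₁ - z₂)(z₁ - z₃)(z₃² + 2ρ₁z₂z₃ + ρ₂²z₂²)`. -/
abbrev legendrePencil (ρ₁ ρ₂ : K) : wproj (legendrePencilIdeal ρ₁ ρ₂) ⟶ Spec (.of K) :=
  wprojToSpec (legendrePencilIdeal ρ₁ ρ₂)

/-- The K3 surface of the twisted Legendre pencil: the minimal resolution of the double sextic. -/
abbrev LegendreK3 (ρ₁ ρ₂ : K) :=
  MinimalResolution (legendrePencil ρ₁ ρ₂)

/-- The coordinate functions `z₁, z₃, y` of the chart `z₂ = 1`. -/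
def LegendreK3.coords {ρ₁ ρ₂ : K} (S : LegendreK3 ρ₁ ρ₂) : Fin 3 → S.FunctionField :=
  ![S.coord 1 rfl 0, S.coord 1 rfl 2, S.coord 1 rfl 3]

/-- The two-form `dz₁ ∧ dz₃ / y`. -/
def LegendreK3.form {ρ₁ ρ₂ : K} (S : LegendreK3 ρ₁ ρ₂) : TwoForm K S.FunctionField :=
  natForm K (LegendreK3.coords S 0) (LegendreK3.coords S 1) (LegendreK3.coords S 2)

end Surfaces

end

end KummerSandwich

/-!
In its affine chart each surface is a double plane `y² = f(x₀, x₁)`, and its function field is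
determined by the generic point of that plane. Hence a dominant rational map between two of the
surfaces is the same as a point `r` of the target double plane, with values in the function field of
the source, whose coordinates `r₀`, `r₁` are algebraically independent. In characteristic zero
`r₀`, `r₁` are algebraically independent as soon as `dr₀ ∧ dr₁ ≠ 0`, so it is enough to exhibit
points with `dr₀ ∧ dr₁ = J • dp₀ ∧ dp₁`, `J ≠ 0` and `r₂ = J p₂`, where `p` is the generic point of
the source: the last equation says exactly that `dr₀ ∧ dr₁ / r₂` is the two-form of the source.

The three points have a geometric origin. The first depends on the base coordinates `x₁`, `x₂`
through `x₂ / x₁` and the ratio `w₁ / w₂`, where `wₗ = 1 - xₗ / Λₗ`. The second is the fibrewise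
two-isogeny `s = x (x - 1) / (x - t)` of the twisted Legendre pencil, followed by the change of
variables `(s, t) ↦ (r, s / r)` with `r` a Möbius transform of `s`, which turns the isogenous pencil
into the isogenous Kummer surface. The third is the product of the dual isogenies
`x ↦ (x + 1)² / (4 x)`.
-/

namespace KummerSandwich

noncomputable section

section JacobianCriterion

lemma exists_pderiv_ne_zero {R σ : Type*} [CommRing R] [IsDomain R] [CharZero R]
    {P : MvPolynomial σ R} (hP : P.totalDegree ≠ 0) : ∃ i, pderiv i P ≠ 0 := by
  contrapose! hP
  rw [totalDegree_eq_zero_iff]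
  intro m hm i
  by_contra hmi
  have h := congrArg (coeff (m - Finsupp.single i 1)) (hP i)
  rw [coeff_pderiv, coeff_zero, tsub_add_cancel_of_le
    (Finsupp.single_le_iff.2 (Nat.one_le_iff_ne_zero.2 hmi))] at h
  exact mul_ne_zero (mem_support_iff.1 hm) (Nat.cast_add_one_ne_zero _) h

lemma totalDegree_pderiv_lt {R σ : Type*} [CommSemiring R] {P : MvPolynomial σ R} {i : σ}
    (hP : pderiv i P ≠ 0) : (pderiv i P).totalDegree < P.totalDegree := by
  have hdeg : ∀ m ∈ (pderiv i P).support, (m.sum fun _ e => e) + 1 ≤ P.totalDegree := by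
    intro m hm
    rw [mem_support_iff, coeff_pderiv] at hm
    have h := le_totalDegree (mem_support_iff.2 (left_ne_zero_of_mul hm))
    rwa [Finsupp.sum_add_index' (fun _ => rfl) (fun _ _ _ => rfl),
      Finsupp.sum_single_index rfl] at h
  obtain ⟨m, hm⟩ := support_nonempty.2 hP
  exact (Finset.sup_lt_iff ((Nat.succ_pos _).trans_le (hdeg m hm))).2 hdeg

lemma derivation_aeval {R A M σ : Type*} [Fintype σ] [CommRing R] [CommRing A] [Algebra R A]
    [AddCommGroup M] [Module A M] [Module R M] (D : Derivation R A M) (x : σ → A)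
    (P : MvPolynomial σ R) : D (aeval x P) = ∑ i, aeval x (pderiv i P) • D (x i) := by
  induction P using MvPolynomial.induction_on with
  | C r => simp
  | add P Q hP hQ => simp only [map_add, hP, hQ, add_smul, Finset.sum_add_distrib]
  | mul_X P j hP =>
    classical
    simp only [map_mul, aeval_X, Derivation.leibniz, hP, pderiv_X, smul_eq_mul, map_add, add_smul,
      Finset.sum_add_distrib, Finset.smul_sum, smul_smul, Pi.single_apply]
    simp

lemma algebraicIndependent_of_linearIndependent_D {K F ι : Type*} [Field K] [CharZero K] [Field F]
    [Algebra K F] {x : ι → F}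
    (hx : LinearIndependent F fun i => KaehlerDifferential.D K F (x i)) :
    AlgebraicIndependent K x := by
  refine algebraicIndependent_of_finite_type fun t ht => ?_
  have := ht.fintype
  rw [algebraicIndependent_iff]
  intro P hP
  induction hn : P.totalDegree using Nat.strong_induction_on generalizing P with
  | _ n ih =>
    subst hn
    have hpderiv : ∀ i, pderiv i P = 0 := by
      intro i
      by_contra hi
      refine hi (ih _ (totalDegree_pderiv_lt hi) _ ?_ rfl)
      refine Fintype.linearIndependent_iff.1 (hx.comp _ Subtype.val_injective)
        (fun i : t => aeval (fun i : t => x i) (pderiv i P)) ?_ i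
      simp only [Function.comp_apply]
      rw [← derivation_aeval, hP, map_zero]
    have hdeg : P.totalDegree = 0 := by
      by_contra h
      obtain ⟨i, hi⟩ := exists_pderiv_ne_zero h
      exact hi (hpderiv i)
    rw [totalDegree_eq_zero_iff_eq_C.1 hdeg] at hP ⊢
    rw [aeval_C, map_eq_zero] at hP
    rw [hP, C_0]

lemma aeval_ne_zero_of_eval_ne_zero {R A σ : Type*} [CommRing R] [CommRing A] [Algebra R A]
    {x : σ → A} (hx : AlgebraicIndependent R x) {P : MvPolynomial σ R} (v : σ → R)
    (hv : eval v P ≠ 0) : aeval x P ≠ 0 := fun h =>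
  hv (by rw [hx (h.trans (map_zero _).symm), map_zero])

lemma formallyEtale_of_isAlgebraic (R F : Type*) [CommRing R] [IsDomain R] [CharZero R] [Field F]
    [Algebra R F] [FaithfulSMul R F] [Algebra.IsAlgebraic R F] : Algebra.FormallyEtale R F := by
  let : Algebra (FractionRing R) F := FractionRing.liftAlgebra R F
  have : IsScalarTower R (FractionRing R) F := FractionRing.isScalarTower_liftAlgebra R F
  have : CharZero (FractionRing R) :=
    charZero_of_injective_algebraMap (IsFractionRing.injective R (FractionRing R))
  have : Algebra.IsAlgebraic (FractionRing R) F :=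
    (IsFractionRing.comap_isAlgebraic_iff (A := R)).1 ‹_›
  have : Algebra.FormallyEtale R (FractionRing R) := .of_isLocalization (nonZeroDivisors R)
  have : Algebra.FormallyEtale (FractionRing R) F := .of_isSeparable _ _
  exact .comp R (FractionRing R) F

variable {K F ι : Type*} [Field K] [CharZero K] [Field F] [Algebra K F]

lemma linearIndependent_D_of_isTranscendenceBasis {x : ι → F} (hx : IsTranscendenceBasis K x) :
    LinearIndependent F fun i => KaehlerDifferential.D K F (x i) := by
  let : Algebra (MvPolynomial ι K) F := (aeval x).toAlgebra
  have hmap : ∀ P, algebraMap (MvPolynomial ι K) F P = aeval x P := fun _ => rfl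
  have : IsScalarTower K (MvPolynomial ι K) F :=
    .of_algebraMap_eq fun k => by rw [hmap, algebraMap_eq, aeval_C]
  have : FaithfulSMul (MvPolynomial ι K) F :=
    (faithfulSMul_iff_algebraMap_injective _ F).2 hx.1
  have : Algebra.IsAlgebraic (MvPolynomial ι K) F :=
    hx.isAlgebraic_iff.2 fun i => by
      simpa [hmap] using isAlgebraic_algebraMap (R := MvPolynomial ι K) (A := F) (X i)
  have := formallyEtale_of_isAlgebraic (MvPolynomial ι K) F
  let b := ((KaehlerDifferential.mvPolynomialBasis K ι).baseChange F).map
    (KaehlerDifferential.tensorKaehlerEquivOfFormallyEtale K (MvPolynomial ι K) F)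
  convert b.linearIndependent with i
  simp [b, hmap]

lemma algebraicIndependent_iff_linearIndependent_D {x : ι → F} :
    AlgebraicIndependent K x ↔ LinearIndependent F fun i => KaehlerDifferential.D K F (x i) := by
  refine ⟨fun hx => ?_, algebraicIndependent_of_linearIndependent_D⟩
  obtain ⟨t, hxt, ht⟩ := exists_isTranscendenceBasis_superset hx.coe_range
  exact (linearIndependent_D_of_isTranscendenceBasis ht).comp
    (fun i => ⟨x i, hxt ⟨i, rfl⟩⟩) fun i j h => hx.injective (congrArg Subtype.val h)

end JacobianCriterion

section TwoForms

lemma ιMulti_ne_zero_iff {F M : Type*} [Field F] [AddCommGroup M] [Module F M] {n : ℕ}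
    {v : Fin n → M} : exteriorPower.ιMulti F n v ≠ 0 ↔ LinearIndependent F v := by
  refine ⟨fun h => ?_, fun hv h => ?_⟩
  · by_contra hv
    exact h ((exteriorPower.ιMulti F n).map_linearDependent v hv)
  · obtain ⟨f, hf⟩ := LinearMap.exists_leftInverse_of_injective
      (Fintype.linearCombination F v) (LinearMap.ker_eq_bot.2 hv.fintypeLinearCombination_injective)
    have hfv : f ∘ v = Pi.basisFun F (Fin n) := by
      ext1 i
      simpa using congr($hf (Pi.single i 1))
    let ω := (Pi.basisFun F (Fin n)).det.compLinearMap f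
    have hω : exteriorPower.alternatingMapLinearEquiv ω (exteriorPower.ιMulti F n v) = 1 := by
      rw [exteriorPower.alternatingMapLinearEquiv_apply_ιMulti, ← (Pi.basisFun F (Fin n)).det_self,
        ← hfv]
      rfl
    rw [h, map_zero] at hω
    exact zero_ne_one hω

variable {K F : Type u} [Field K] [Field F] [Algebra K F]

/-- The two-form `dx ∧ dy`. -/
def wedge (K : Type u) {F : Type u} [Field K] [Field F] [Algebra K F] (x y : F) : TwoForm K F :=
  exteriorPower.ιMulti F 2 ![KaehlerDifferential.D K F x, KaehlerDifferential.D K F y]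

lemma wedge_ne_zero_iff_algebraicIndependent [CharZero K] {x y : F} :
    wedge K x y ≠ 0 ↔ AlgebraicIndependent K ![x, y] := by
  rw [algebraicIndependent_iff_linearIndependent_D, wedge, ιMulti_ne_zero_iff]
  congr! with i
  fin_cases i <;> rfl

lemma natForm_eq_smul_wedge (x y t : F) : natForm K x y t = t⁻¹ • wedge K x y := rfl

lemma natForm_eq_of_wedge_eq_smul {u v x t y J : F} (hJ : J ≠ 0)
    (h : wedge K u v = J • wedge K x t) : natForm K u v (J * y) = natForm K x t y := by
  rw [natForm_eq_smul_wedge, natForm_eq_smul_wedge, h, smul_smul, mul_inv_rev,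
    inv_mul_cancel_right₀ hJ]

lemma ιMulti_pair_add_smul {R M : Type*} [CommRing R] [AddCommGroup M] [Module R M] (a b c d : R)
    (α β : M) : exteriorPower.ιMulti R 2 ![a • α + b • β, c • α + d • β] =
      (a * d - b * c) • exteriorPower.ιMulti R 2 ![α, β] := by
  set ω := exteriorPower.ιMulti R 2 (M := M)
  have hcomb : ∀ (a b : R) (α β γ : M), ω ![a • α + b • β, γ] = a • ω ![α, γ] + b • ω ![β, γ] := by
    intro a b α β γ
    have h := ω.map_vecCons_add ![γ] (a • α) (b • β)
    rwa [ω.map_vecCons_smul, ω.map_vecCons_smul] at h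
  have hself : ∀ α : M, ω ![α, α] = 0 := fun α =>
    ω.map_eq_zero_of_eq ![α, α] (i := 0) (j := 1) rfl (by decide)
  have hswap : ∀ α β : M, ω ![β, α] = -ω ![α, β] := by
    intro α β
    rw [← ω.map_swap ![α, β] (i := 0) (j := 1) (by decide)]
    congr 1
    ext i
    fin_cases i <;> rfl
  rw [hcomb, hswap _ α, hswap _ β, hcomb, hcomb, hself, hself, hswap α β]
  module

lemma wedge_eq_smul_wedge {x t u v a b c d : F}
    (hu : KaehlerDifferential.D K F u =
      a • KaehlerDifferential.D K F x + b • KaehlerDifferential.D K F t)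
    (hv : KaehlerDifferential.D K F v =
      c • KaehlerDifferential.D K F x + d • KaehlerDifferential.D K F t) :
    wedge K u v = (a * d - b * c) • wedge K x t := by
  rw [wedge, wedge, hu, hv, ιMulti_pair_add_smul]

end TwoForms

section DoublePlane

lemma eq_zero_of_sq_eq_mul_sq {R σ : Type*} [CommRing R] [IsDomain R] {f b c : MvPolynomial σ R}
    {i : σ} (hf : Odd (degreeOf i f)) (h : b ^ 2 = f * c ^ 2) : c = 0 := by
  by_contra hc
  have hf0 : f ≠ 0 := by
    rintro rfl
    simp at hf
  have hb : b ≠ 0 := by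
    rintro rfl
    rw [zero_pow two_ne_zero] at h
    exact mul_ne_zero hf0 (pow_ne_zero 2 hc) h.symm
  have hdeg := congrArg (degreeOf i) h
  rw [degreeOf_pow_eq i b 2 hb, degreeOf_mul_eq hf0 (pow_ne_zero 2 hc),
    degreeOf_pow_eq i c 2 hc] at hdeg
  obtain ⟨k, hk⟩ := hf
  omega

variable {R A B : Type*} [CommRing R] [CommRing A] [Algebra R A] [CommRing B] [Algebra R B]

lemma algHom_aeval_pair (ψ : A →ₐ[R] B) (x y : A) (q : MvPolynomial (Fin 2) R) :
    ψ (aeval ![x, y] q) = aeval ![ψ x, ψ y] q := by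
  have h : ψ.comp (aeval ![x, y]) = aeval ![ψ x, ψ y] := by
    ext i
    fin_cases i <;> simp
  exact congr($h q)

/-- The triple `a = (x₀, x₁, y)` is a point of the double plane `y² = f(x₀, x₁)` with values in the
algebra `A`. -/
def OnDoublePlane (f : MvPolynomial (Fin 2) R) (a : Fin 3 → A) : Prop :=
  a 2 ^ 2 = aeval ![a 0, a 1] f

variable {f : MvPolynomial (Fin 2) R} {a : Fin 3 → A}

lemma OnDoublePlane.exists_eq_add_mul (ha : OnDoublePlane f a)
    (hgen : Algebra.adjoin R (Set.range a) = ⊤) (x : A) :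
    ∃ b c : MvPolynomial (Fin 2) R, x = aeval ![a 0, a 1] b + aeval ![a 0, a 1] c * a 2 := by
  have hx : x ∈ Algebra.adjoin R (Set.range a) := hgen ▸ Algebra.mem_top
  induction hx using Algebra.adjoin_induction with
  | mem x hx =>
    obtain ⟨i, rfl⟩ := hx
    fin_cases i
    · exact ⟨X 0, 0, by simp⟩
    · exact ⟨X 1, 0, by simp⟩
    · exact ⟨0, 1, by simp⟩
  | algebraMap r => exact ⟨C r, 0, by simp⟩
  | add x y _ _ hx hy =>
    obtain ⟨b, c, rfl⟩ := hx
    obtain ⟨b', c', rfl⟩ := hy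
    exact ⟨b + b', c + c', by simp only [map_add]; ring⟩
  | mul x y _ _ hx hy =>
    obtain ⟨b, c, rfl⟩ := hx
    obtain ⟨b', c', rfl⟩ := hy
    refine ⟨b * b' + c * c' * f, b * c' + c * b', ?_⟩
    simp only [map_add, map_mul]
    rw [OnDoublePlane] at ha
    linear_combination (aeval ![a 0, a 1] c) * (aeval ![a 0, a 1] c') * ha

lemma OnDoublePlane.map (ha : OnDoublePlane f a) (ψ : A →ₐ[R] B) : OnDoublePlane f (ψ ∘ a) := by
  have h := congrArg ψ ha
  rwa [map_pow, algHom_aeval_pair] at h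

lemma OnDoublePlane.injective_of_algebraicIndependent [IsDomain R] (ha : OnDoublePlane f a)
    (hgen : Algebra.adjoin R (Set.range a) = ⊤) {i : Fin 2} (hf : Odd (degreeOf i f))
    (ψ : A →ₐ[R] B) (hψ : AlgebraicIndependent R ![ψ (a 0), ψ (a 1)]) :
    Function.Injective ψ := by
  rw [injective_iff_map_eq_zero]
  intro x hx
  obtain ⟨b, c, rfl⟩ := ha.exists_eq_add_mul hgen x
  have hy : ψ (a 2) ^ 2 = aeval ![ψ (a 0), ψ (a 1)] f := ha.map ψ
  rw [map_add, map_mul, algHom_aeval_pair, algHom_aeval_pair] at hx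
  have h : b ^ 2 = f * c ^ 2 := by
    apply hψ
    simp only [map_mul, map_pow]
    rw [← hy]
    linear_combination (aeval ![ψ (a 0), ψ (a 1)] b - aeval ![ψ (a 0), ψ (a 1)] c * ψ (a 2)) * hx
  have hc := eq_zero_of_sq_eq_mul_sq hf h
  have hb : b = 0 := by
    rw [hc] at h
    simpa using h
  simp [hb, hc]

lemma exists_onDoublePlane_algebraicIndependent {K : Type u} [Field K]
    (f : MvPolynomial (Fin 2) K) :
    ∃ (L : Type u) (_ : Field L) (_ : Algebra K L) (p : Fin 3 → L), OnDoublePlane f p ∧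
      AlgebraicIndependent K ![p 0, p 1] := by
  let L := AlgebraicClosure (FractionRing (MvPolynomial (Fin 2) K))
  let ι : MvPolynomial (Fin 2) K →ₐ[K] L := IsScalarTower.toAlgHom K _ L
  have hι : Function.Injective ι :=
    (algebraMap (FractionRing (MvPolynomial (Fin 2) K)) L).injective.comp
      (IsFractionRing.injective (MvPolynomial (Fin 2) K) _)
  have hX : aeval ![ι (X 0), ι (X 1)] = ι := by
    ext i
    fin_cases i <;> simp
  obtain ⟨y, hy⟩ := IsAlgClosed.exists_pow_nat_eq (ι f) two_pos
  refine ⟨L, inferInstance, inferInstance, ![ι (X 0), ι (X 1), y], ?_, ?_⟩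
  · simp only [OnDoublePlane, Matrix.cons_val]
    rw [hy, hX]
  · simp only [Matrix.cons_val_zero, Matrix.cons_val_one, AlgebraicIndependent]
    rwa [hX]

end DoublePlane

section Chart

variable {K : Type u} [Field K] {m : ℕ} {w : Fin m → ℕ}
  (I : HomogeneousIdeal (weightedHomogeneousSubmodule K w))

/-- The coordinate ring of the chart `X_c ≠ 0` of `V₊(I)`. -/
abbrev ChartRing (c : Fin m) : Type u :=
  HomogeneousLocalization.Away (coordGrading I) (Ideal.Quotient.mk I.toIdeal (X c))

namespace ChartRing

instance algebra (c : Fin m) : Algebra K (ChartRing I c) :=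
  ((HomogeneousLocalization.fromZeroRingHom (coordGrading I) _).comp
    (algebraMap K (coordGrading I 0))).toAlgebra

/-- The inclusion of the chart ring in the localised homogeneous coordinate ring. -/
def val (c : Fin m) : ChartRing I c →ₐ[K]
    Localization.Away (Ideal.Quotient.mk I.toIdeal (X c)) where
  __ := algebraMap (ChartRing I c) (Localization.Away (Ideal.Quotient.mk I.toIdeal (X c)))
  commutes' r := by
    change Localization.mk (algebraMap K (coordGrading I 0) r).1 1 = _
    rw [IsScalarTower.algebraMap_apply K (MvPolynomial (Fin m) K ⧸ I.toIdeal)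
      (Localization.Away (Ideal.Quotient.mk I.toIdeal (X c)))]
    exact Localization.mk_one_eq_algebraMap _

variable (c : Fin m)

lemma val_injective : Function.Injective (val I c) :=
  HomogeneousLocalization.val_injective _

lemma val_mk_mul_pow {d n : ℕ} (hd : Ideal.Quotient.mk I.toIdeal (X c) ∈ coordGrading I d)
    (a : MvPolynomial (Fin m) K ⧸ I.toIdeal) (ha : a ∈ coordGrading I (n • d)) :
    val I c (HomogeneousLocalization.Away.mk (coordGrading I) hd n a ha) *
      algebraMap _ _ (Ideal.Quotient.mk I.toIdeal (X c)) ^ n = algebraMap _ _ a := by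
  change Localization.mk _ _ * _ = _
  rw [← Localization.mk_one_eq_algebraMap, ← Localization.mk_one_eq_algebraMap,
    Localization.mk_pow, Localization.mk_mul, Localization.mk_eq_mk_iff,
    Localization.r_iff_exists]
  exact ⟨1, by simp; ring⟩

variable (hc : w c = 1)

lemma val_affineCoord_mul_pow (j : Fin m) :
    val I c (affineCoord I c hc j) * algebraMap _ _ (Ideal.Quotient.mk I.toIdeal (X c)) ^ w j =
      algebraMap _ _ (Ideal.Quotient.mk I.toIdeal (X j)) :=
  val_mk_mul_pow I c _ _ _

lemma aeval_affineCoord {p : MvPolynomial (Fin m) K} {n : ℕ} (hp : IsWeightedHomogeneous w p n) :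
    aeval (affineCoord I c hc) p = HomogeneousLocalization.Away.mk (coordGrading I) (var_mem I c) n
      (Ideal.Quotient.mk I.toIdeal p) (by simpa [hc] using mk_mem_quotGrading _ I hp) := by
  apply val_injective I c
  set u := algebraMap _ (Localization.Away (Ideal.Quotient.mk I.toIdeal (X c)))
    (Ideal.Quotient.mk I.toIdeal (X c)) with hu
  have hunit : IsUnit u := IsLocalization.Away.algebraMap_isUnit _
  refine (hunit.pow n).mul_right_cancel ?_
  rw [val_mk_mul_pow]
  conv_rhs => rw [← aeval_X_left_apply p]
  rw [aeval_def, aeval_def, eval₂_eq', eval₂_eq', map_sum, Finset.sum_mul, map_sum, map_sum]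
  refine Finset.sum_congr rfl fun d hd => ?_
  have hdeg := hp (mem_support_iff.1 hd)
  rw [Finsupp.weight_apply, Finsupp.sum_fintype _ _ (by simp)] at hdeg
  rw [← hdeg, ← Finset.prod_pow_eq_pow_sum]
  simp only [map_mul, map_prod, map_pow, AlgHom.commutes]
  rw [mul_assoc, ← Finset.prod_mul_distrib]
  congr 1
  refine Finset.prod_congr rfl fun j _ => ?_
  rw [← val_affineCoord_mul_pow I c hc j, ← hu, mul_pow, ← pow_mul, smul_eq_mul, mul_comm (d j)]

lemma aeval_affineCoord_eq_zero {p : MvPolynomial (Fin m) K} {n : ℕ}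
    (hp : IsWeightedHomogeneous w p n) (hpI : p ∈ I.toIdeal) :
    aeval (affineCoord I c hc) p = 0 := by
  rw [aeval_affineCoord I c hc hp]
  exact HomogeneousLocalization.mk_eq_zero_of_num _
    (Subtype.ext (Ideal.Quotient.eq_zero_iff_mem.2 hpI))

lemma affineCoord_self : affineCoord I c hc c = 1 := by
  apply val_injective I c
  have h := val_affineCoord_mul_pow I c hc c
  rw [hc, pow_one] at h
  rw [map_one]
  exact (IsLocalization.Away.algebraMap_isUnit _).mul_right_cancel (h.trans (one_mul _).symm)

lemma adjoin_affineCoord : Algebra.adjoin K (Set.range (affineCoord I c hc)) = ⊤ := by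
  rw [eq_top_iff, Algebra.adjoin_range_eq_range_aeval]
  rintro x -
  obtain ⟨n, _, ⟨p, hp, rfl⟩, rfl⟩ :=
    HomogeneousLocalization.Away.mk_surjective (coordGrading I) (var_mem I c) x
  have hp' : IsWeightedHomogeneous w p n := by simpa [hc] using hp
  exact ⟨p, aeval_affineCoord I c hc hp'⟩

lemma exists_algHom {L : Type*} [CommRing L] [Algebra K L] (q : Fin m → L)
    (hq : ∀ p ∈ I.toIdeal, aeval q p = 0) (hqc : q c = 1) :
    ∃ ψ : ChartRing I c →ₐ[K] L, ∀ j, ψ (affineCoord I c hc j) = q j := by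
  let φ : (MvPolynomial (Fin m) K ⧸ I.toIdeal) →ₐ[K] L := Ideal.Quotient.liftₐ _ (aeval q) hq
  have hφ (j : Fin m) : φ (Ideal.Quotient.mk I.toIdeal (X j)) = q j := by
    change aeval q (X j) = q j
    simp
  have hunit (y : Submonoid.powers (Ideal.Quotient.mk I.toIdeal (X c))) : IsUnit (φ y) := by
    obtain ⟨_, n, rfl⟩ := y
    simp [hφ, hqc]
  let Φ : Localization.Away (Ideal.Quotient.mk I.toIdeal (X c)) →ₐ[K] L :=
    IsLocalization.liftAlgHom (M := Submonoid.powers (Ideal.Quotient.mk I.toIdeal (X c)))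
      (f := φ) hunit
  have hΦ (y) : Φ (algebraMap _ _ y) = φ y := by
    simp only [Φ, IsLocalization.liftAlgHom_apply, IsLocalization.lift_eq]
    rfl
  refine ⟨Φ.comp (val I c), fun j => ?_⟩
  have h := congrArg Φ (val_affineCoord_mul_pow I c hc j)
  rwa [map_mul, map_pow, hΦ, hΦ, hφ, hφ, hqc, one_pow, mul_one] at h

section Generators

variable {s : Set (MvPolynomial (Fin m) K)} {hs : ∀ p ∈ s, ∃ n, IsWeightedHomogeneous w p n}

lemma aeval_affineCoord_eq_zero_of_mem {p : MvPolynomial (Fin m) K} (hp : p ∈ s) :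
    aeval (affineCoord (idealOf w s hs) c hc) p = 0 :=
  aeval_affineCoord_eq_zero _ c hc (hs p hp).choose_spec (Ideal.subset_span hp)

lemma exists_algHom_idealOf {L : Type*} [CommRing L] [Algebra K L] (q : Fin m → L)
    (hq : ∀ p ∈ s, aeval q p = 0) (hqc : q c = 1) :
    ∃ ψ : ChartRing (idealOf w s hs) c →ₐ[K] L,
      ∀ j, ψ (affineCoord (idealOf w s hs) c hc j) = q j := by
  refine exists_algHom _ c hc q (fun p hp => ?_) hqc
  have hle : Ideal.span s ≤ RingHom.ker (aeval q) := Ideal.span_le.2 hq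
  exact hle hp

end Generators

end ChartRing

end Chart

section GenericPoint

lemma isFractionRing_of_isLocalization_atPrime {A F : Type*} [CommRing A] [IsDomain A] [Field F]
    [Algebra A F] (p : Ideal A) [p.IsPrime] [IsLocalization.AtPrime F p] : IsFractionRing A F := by
  have hp := p.primeCompl_le_nonZeroDivisors
  refine IsLocalization.of_le p.primeCompl _ hp fun a ha => IsUnit.mk0 _ ?_
  exact (map_ne_zero_iff _ (IsLocalization.injective F hp)).2 (nonZeroDivisors.ne_zero ha)

variable {K : Type u} [Field K] {S Z : Scheme.{u}} {z : Z ⟶ Spec (.of K)} {g : S ⟶ Z}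

lemma IsResolution.nonempty_preimage (hg : IsResolution z g) (V : Z.Opens)
    (hV : (V : Set Z).Nonempty) : Nonempty (g ⁻¹ᵁ V) := by
  obtain ⟨U, hU, -, _⟩ := hg.birational
  obtain ⟨p, hpV, hpU⟩ := hU.inter_open_nonempty V V.isOpen hV
  obtain ⟨s, hs⟩ := (g ∣_ U).surjective ⟨p, hpU⟩
  have hsp := congrArg Subtype.val hs
  rw [morphismRestrict_base_coe] at hsp
  exact ⟨⟨s.1, show g s.1 ∈ V by rwa [hsp]⟩⟩

variable [IsIntegral S]

lemma IsResolution.isIso_stalkMap_genericPoint (hg : IsResolution z g) :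
    IsIso (g.stalkMap (genericPoint S)) := by
  obtain ⟨U, -, hU, _⟩ := hg.birational
  have hη : genericPoint S ∈ g ⁻¹ᵁ U :=
    ((genericPoint_spec S).mem_open_set_iff (g ⁻¹ᵁ U).isOpen).2 (by simpa using hU.nonempty)
  let η : (g ⁻¹ᵁ U).toScheme := ⟨genericPoint S, hη⟩
  have h : IsIso ((g ∣_ U).stalkMap η) := inferInstance
  exact ((MorphismProperty.isomorphisms _).arrow_mk_iso_iff (morphismRestrictStalkMap g U η)).1 h

variable (g) (V : Z.Opens) [Nonempty (g ⁻¹ᵁ V)]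

/-- The homomorphism from the sections of `Z` over `V` to the function field of `S`, given by
pullback along `g`. -/
def genericSection : Γ(Z, V) ⟶ S.functionField :=
  g.app V ≫ S.germToFunctionField (g ⁻¹ᵁ V)

lemma map_genericPoint_mem : g (genericPoint S) ∈ V :=
  ((genericPoint_spec S).mem_open_set_iff (g ⁻¹ᵁ V).isOpen).2
    (by simpa using ‹Nonempty (g ⁻¹ᵁ V)›)

lemma genericSection_eq_germ_stalkMap :
    genericSection g V =
      Z.presheaf.germ V _ (map_genericPoint_mem g V) ≫ g.stalkMap (genericPoint S) := by
  rw [Scheme.Hom.germ_stalkMap]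
  rfl

variable {V}

lemma fromSpecStalk_genericPoint_comp (hV : IsAffineOpen V) :
    S.fromSpecStalk (genericPoint S) ≫ g = Spec.map (genericSection g V) ≫ hV.fromSpec := by
  rw [genericSection_eq_germ_stalkMap, Spec.map_comp, Category.assoc,
    ← Scheme.SpecMap_stalkMap_fromSpecStalk,
    ← hV.fromSpecStalk_eq_fromSpecStalk (map_genericPoint_mem g V)]
  rfl

variable {g}

lemma IsResolution.isFractionRing_genericSection (hg : IsResolution z g) (hV : IsAffineOpen V)
    [IsDomain Γ(Z, V)] : @IsFractionRing Γ(Z, V) _ S.functionField _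
      (genericSection g V).hom.toAlgebra := by
  have := hg.isIso_stalkMap_genericPoint
  let η : V := ⟨_, map_genericPoint_mem g V⟩
  let := (genericSection g V).hom.toAlgebra
  let := Z.presheaf.algebra_section_stalk η
  have hloc := hV.isLocalization_stalk η
  let e : Z.presheaf.stalk η.1 ≃ₐ[Γ(Z, V)] S.functionField := AlgEquiv.ofRingEquiv
    (f := (asIso (g.stalkMap (genericPoint S))).commRingCatIsoToRingEquiv)
    fun a => congr($((genericSection_eq_germ_stalkMap g V).symm).hom a)
  have : IsLocalization.AtPrime S.functionField (hV.primeIdealOf η).asIdeal :=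
    IsLocalization.isLocalization_of_algEquiv _ e
  exact isFractionRing_of_isLocalization_atPrime (hV.primeIdealOf η).asIdeal

end GenericPoint

lemma fromSpec_isAffineOpen_basicOpen {A σ : Type*} [CommRing A] [SetLike σ A]
    [AddSubgroupClass σ A] (𝒜 : ℕ → σ) [GradedRing 𝒜] {f : A} {m : ℕ} (f_deg : f ∈ 𝒜 m)
    (hm : 0 < m) :
    (Proj.isAffineOpen_basicOpen 𝒜 f f_deg hm).fromSpec =
      Spec.map (Proj.awayToSection 𝒜 f) ≫ Proj.awayι 𝒜 f f_deg hm := by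
  rw [← cancel_epi (Proj.isAffineOpen_basicOpen 𝒜 f f_deg hm).isoSpec.hom,
    IsAffineOpen.isoSpec_hom_fromSpec, IsAffineOpen.isoSpec_hom, ← Category.assoc]
  change _ = Proj.basicOpenToSpec 𝒜 f ≫ _
  rw [← Proj.basicOpenIsoSpec_hom 𝒜 f f_deg hm, ← Proj.basicOpenIsoSpec_inv_ι,
    Iso.hom_inv_id_assoc]

section ChartFunctions

variable {K : Type u} [Field K] {m : ℕ} {w : Fin m → ℕ}

/-- The chart `X_c ≠ 0` of `V₊(I)`. -/
abbrev chart (I : HomogeneousIdeal (weightedHomogeneousSubmodule K w)) (c : Fin m) :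
    (wproj I).Opens :=
  Proj.basicOpen (coordGrading I) (Ideal.Quotient.mk I.toIdeal (X c))

/-- The functions on the chart `X_c ≠ 0` as sections of the structure sheaf. -/
def chartSection (I : HomogeneousIdeal (weightedHomogeneousSubmodule K w)) (c : Fin m) :
    CommRingCat.of (ChartRing I c) ⟶ Γ(wproj I, chart I c) :=
  Proj.awayToSection (coordGrading I) (Ideal.Quotient.mk I.toIdeal (X c))

variable {I : HomogeneousIdeal (weightedHomogeneousSubmodule K w)} {c : Fin m}

lemma isAffineOpen_chart (hc : w c = 1) : IsAffineOpen (chart I c) :=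
  Proj.isAffineOpen_basicOpen _ _ (var_mem I c) (by omega)

lemma chart_nonempty (hc : w c = 1) [Nontrivial (ChartRing I c)] :
    (chart I c : Set (wproj I)).Nonempty := by
  have hw : 0 < w c := by omega
  obtain ⟨p⟩ : Nonempty (PrimeSpectrum (ChartRing I c)) := inferInstance
  have hp : Proj.awayι (coordGrading I) _ (var_mem I c) hw p ∈
      (Proj.awayι (coordGrading I) _ (var_mem I c) hw).opensRange := ⟨p, rfl⟩
  rw [Proj.opensRange_awayι] at hp
  exact ⟨_, hp⟩

lemma isIso_chartSection (hc : w c = 1) : IsIso (chartSection I c) :=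
  (Proj.basicOpenIsoAway (coordGrading I) _ (var_mem I c) (by omega)).isIso_hom

namespace MinimalResolution

variable (S : MinimalResolution (wprojToSpec I))

lemma nonempty_preimage_chart (hc : w c = 1) [Nontrivial (ChartRing I c)] :
    Nonempty (S.map ⁻¹ᵁ chart I c) :=
  S.isResolution.nonempty_preimage _ (chart_nonempty hc)

variable [Nonempty (S.map ⁻¹ᵁ chart I c)]

variable (c) in
/-- The homomorphism from a chart ring to the function field of the resolution. -/
def chartHom : ChartRing I c →+* S.FunctionField :=
  (chartSection I c ≫ genericSection S.map (chart I c)).hom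

lemma coord_eq_chartHom_affineCoord (hc : w c = 1) (j : Fin m) :
    S.coord c hc j = S.chartHom c (affineCoord I c hc j) := by
  unfold MinimalResolution.coord
  exact dif_pos ‹_›

lemma generic_comp_map (hc : w c = 1) :
    S.generic ≫ S.map = Spec.map (CommRingCat.ofHom (S.chartHom c)) ≫
      Proj.awayι (coordGrading I) _ (var_mem I c) (by omega) := by
  have hhom : CommRingCat.ofHom (S.chartHom c) =
      chartSection I c ≫ genericSection S.map (chart I c) := rfl
  rw [MinimalResolution.generic, fromSpecStalk_genericPoint_comp S.map (isAffineOpen_chart hc),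
    hhom, Spec.map_comp, Category.assoc]
  exact congrArg _ (fromSpec_isAffineOpen_basicOpen _ _ _)

lemma chartHom_algebraMap (hc : w c = 1) (r : K) :
    S.chartHom c (algebraMap K (ChartRing I c) r) = algebraMap K S.FunctionField r := by
  have h : S.generic ≫ S.toSpec = Spec.map (CommRingCat.ofHom
      ((S.chartHom c).comp (algebraMap K (ChartRing I c)))) := by
    rw [MinimalResolution.toSpec, ← Category.assoc, S.generic_comp_map hc]
    change (_ ≫ _) ≫ Proj.toSpecZero (coordGrading I) ≫ _ = _
    rw [Category.assoc, Proj.awayι_toSpecZero_assoc, ← Spec.map_comp, ← Spec.map_comp]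
    rfl
  have hpre : Spec.preimage (S.generic ≫ S.toSpec) = CommRingCat.ofHom
      ((S.chartHom c).comp (algebraMap K (ChartRing I c))) := by
    rw [h, Spec.preimage_map]
  exact congr($(hpre.symm).hom r)

lemma isFractionRing_chartHom (hc : w c = 1) [IsDomain (ChartRing I c)] :
    @IsFractionRing (ChartRing I c) _ S.FunctionField _ (S.chartHom c).toAlgebra := by
  have := isIso_chartSection (I := I) hc
  let e := (asIso (chartSection I c)).commRingCatIsoToRingEquiv
  have : IsDomain Γ(wproj I, chart I c) := e.symm.injective.isDomain e.symm.toRingHom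
  let := (genericSection S.map (chart I c)).hom.toAlgebra
  let := (S.chartHom c).toAlgebra
  have := S.isResolution.isFractionRing_genericSection (isAffineOpen_chart (I := I) hc)
  exact IsFractionRing.of_ringEquiv_left e fun _ => rfl

end MinimalResolution

end ChartFunctions

section DoublePlaneField

variable {K : Type u} [Field K]

/-- `A` is the coordinate ring of the double plane `y² = f(x₀, x₁)`, with coordinates `a`; the
universal property is only required for points with values in fields. -/
structure IsDoublePlaneRing {A : Type u} [CommRing A] [Algebra K A] (f : MvPolynomial (Fin 2) K)
    (a : Fin 3 → A) : Prop where
  mem : OnDoublePlane f a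
  gen : Algebra.adjoin K (Set.range a) = ⊤
  lift : ∀ (L : Type u) [Field L] [Algebra K L] (p : Fin 3 → L), OnDoublePlane f p →
    ∃ ψ : A →ₐ[K] L, ∀ i, ψ (a i) = p i

/-- `F` is the function field of the double plane `y² = f(x₀, x₁)`, with coordinates `p`: points
with algebraically independent base coordinates are specialisations of `p`. -/
structure IsDoublePlaneField {F : Type u} [Field F] [Algebra K F] (f : MvPolynomial (Fin 2) K)
    (p : Fin 3 → F) : Prop where
  mem : OnDoublePlane f p
  indep : AlgebraicIndependent K ![p 0, p 1]
  lift : ∀ (L : Type u) [Field L] [Algebra K L] (q : Fin 3 → L), OnDoublePlane f q →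
    AlgebraicIndependent K ![q 0, q 1] → ∃ φ : F →ₐ[K] L, ∀ i, φ (p i) = q i

namespace IsDoublePlaneRing

variable {f : MvPolynomial (Fin 2) K} {A : Type u} [CommRing A] [Algebra K A] {a : Fin 3 → A}
  {i : Fin 2}

lemma exists_injective (ha : IsDoublePlaneRing f a) (hf : Odd (degreeOf i f)) :
    ∃ (L : Type u) (_ : Field L) (_ : Algebra K L) (ψ : A →ₐ[K] L), Function.Injective ψ ∧
      AlgebraicIndependent K ![ψ (a 0), ψ (a 1)] := by
  obtain ⟨L, _, _, p, hp, hind⟩ := exists_onDoublePlane_algebraicIndependent f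
  obtain ⟨ψ, hψ⟩ := ha.lift L p hp
  rw [← hψ, ← hψ] at hind
  exact ⟨L, _, _, ψ, ha.mem.injective_of_algebraicIndependent ha.gen hf ψ hind, hind⟩

lemma isDomain (ha : IsDoublePlaneRing f a) (hf : Odd (degreeOf i f)) : IsDomain A := by
  obtain ⟨L, _, _, ψ, hψ, -⟩ := ha.exists_injective hf
  exact hψ.isDomain ψ.toRingHom

lemma algebraicIndependent (ha : IsDoublePlaneRing f a) (hf : Odd (degreeOf i f)) :
    AlgebraicIndependent K ![a 0, a 1] := by
  obtain ⟨L, _, _, ψ, -, hind⟩ := ha.exists_injective hf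
  intro p q hpq
  apply hind
  rw [← algHom_aeval_pair, ← algHom_aeval_pair]
  exact congrArg ψ hpq

lemma isDoublePlaneField (ha : IsDoublePlaneRing f a) (hf : Odd (degreeOf i f)) {F : Type u}
    [Field F] [Algebra K F] [Algebra A F] [IsScalarTower K A F] [IsFractionRing A F] :
    IsDoublePlaneField f (algebraMap A F ∘ a) where
  mem := ha.mem.map (IsScalarTower.toAlgHom K A F)
  indep := by
    intro p q hpq
    apply ha.algebraicIndependent hf
    apply IsFractionRing.injective A F
    change IsScalarTower.toAlgHom K A F _ = IsScalarTower.toAlgHom K A F _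
    rw [algHom_aeval_pair, algHom_aeval_pair]
    exact hpq
  lift L _ _ q hq hind := by
    obtain ⟨ψ, hψ⟩ := ha.lift L q hq
    rw [← hψ, ← hψ] at hind
    have hinj := ha.mem.injective_of_algebraicIndependent ha.gen hf ψ hind
    refine ⟨IsFractionRing.liftAlgHom (K := F) hinj, fun j => ?_⟩
    rw [← hψ]
    exact IsFractionRing.lift_algebraMap (K := F) hinj (a j)

end IsDoublePlaneRing

lemma MinimalResolution.isDoublePlaneField {m : ℕ} {w : Fin m → ℕ}
    {I : HomogeneousIdeal (weightedHomogeneousSubmodule K w)}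
    (S : MinimalResolution (wprojToSpec I)) {c : Fin m} (hc : w c = 1)
    {f : MvPolynomial (Fin 2) K} {e : Fin 3 → Fin m}
    (ha : IsDoublePlaneRing f (affineCoord I c hc ∘ e)) {i : Fin 2} (hf : Odd (degreeOf i f)) :
    IsDoublePlaneField f (S.coord c hc ∘ e) := by
  have := ha.isDomain hf
  have := S.nonempty_preimage_chart hc
  let := (S.chartHom c).toAlgebra
  have := S.isFractionRing_chartHom hc
  -- `Algebra.toSMul`, since the chart ring also inherits an action of `K` from the polynomial ring.
  have : @IsScalarTower K (ChartRing I c) S.FunctionField Algebra.toSMul _ _ :=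
    .of_algebraMap_eq fun r => (S.chartHom_algebraMap hc r).symm
  have hcoord : S.coord c hc ∘ e = algebraMap _ _ ∘ affineCoord I c hc ∘ e :=
    funext fun j => S.coord_eq_chartHom_affineCoord hc (e j)
  rw [hcoord]
  exact ha.isDoublePlaneField hf

end DoublePlaneField

section DominantMaps

lemma isDominant_of_fromFunctionField_eq {X Y : Scheme.{u}} [IrreducibleSpace X]
    [IrreducibleSpace Y] (r : X ⤏ Y) {p : Spec X.functionField}
    (hp : r.fromFunctionField p = genericPoint Y) : r.IsDominant := by
  obtain ⟨r, rfl⟩ := r.exists_rep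
  rw [Scheme.PartialMap.isDominant_toRationalMap_iff]
  have hmem : genericPoint Y ∈ Set.range r.hom := by
    rw [← hp]
    exact ⟨_, (Scheme.Hom.comp_apply _ _ _).symm⟩
  exact ⟨(dense_iff_closure_eq.2 (genericPoint_closure Y)).mono (Set.singleton_subset_iff.2 hmem)⟩

variable {K : Type u} [Field K] {Z Z' : Scheme.{u}} {z : Z ⟶ Spec (.of K)} {z' : Z' ⟶ Spec (.of K)}

namespace MinimalResolution

lemma generic_toSpec (S : MinimalResolution z) :
    S.generic ≫ S.toSpec = Spec.map (CommRingCat.ofHom (algebraMap K S.FunctionField)) :=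
  (Spec.map_preimage _).symm

lemma generic_apply (S : MinimalResolution z) (p : Spec (.of S.FunctionField)) :
    S.generic p = genericPoint S.surface := by
  have hp : p = IsLocalRing.closedPoint S.FunctionField :=
    Subsingleton.elim (α := PrimeSpectrum S.FunctionField) _ _
  rw [hp]
  exact Scheme.fromSpecStalk_closedPoint

end MinimalResolution

lemma exists_dominantMap_comap_eq {S : MinimalResolution z} {T : MinimalResolution z'}
    (φ : T.FunctionField →ₐ[K] S.FunctionField) : ∃ r : DominantMap S T, r.comap = φ := by
  have hft : LocallyOfFiniteType T.toSpec := by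
    have := T.isResolution.smooth
    change LocallyOfFiniteType (T.map ≫ z')
    infer_instance
  have hover : (Spec.map (CommRingCat.ofHom φ.toRingHom) ≫ T.generic) ≫ T.toSpec =
      S.surface.fromSpecStalk _ ≫ S.toSpec := by
    rw [Category.assoc, T.generic_toSpec, ← Spec.map_comp]
    refine Eq.trans ?_ S.generic_toSpec.symm
    congr 1
    ext k
    exact φ.commutes k
  let r := Scheme.RationalMap.equivFunctionField S.toSpec T.toSpec
    ⟨Spec.map (CommRingCat.ofHom φ.toRingHom) ≫ T.generic, hover⟩
  have hr : r.1.fromFunctionField = Spec.map (CommRingCat.ofHom φ.toRingHom) ≫ T.generic :=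
    Scheme.RationalMap.fromFunctionField_ofFunctionField S.toSpec T.toSpec _ hover
  let p : Spec (.of S.FunctionField) := IsLocalRing.closedPoint S.FunctionField
  have hp : r.1.fromFunctionField p = genericPoint T.surface := by
    rw [hr]
    exact (Scheme.Hom.comp_apply _ _ _).trans (T.generic_apply _)
  exact ⟨⟨r.1, r.2, isDominant_of_fromFunctionField_eq r.1 hp, φ, hr.symm⟩, rfl⟩

end DominantMaps

section Models

variable {K : Type u} [Field K]

/-- The branch polynomial of the double plane underlying `Kum(E₁ × E₂)^(ε)`, in the chart
`z₁ = z₂ = 1`. -/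
def kumBranch (E₁ E₂ : WeierstrassCurve K) (ε : K) : MvPolynomial (Fin 2) K :=
  C ε * (X 0 * (X 0 ^ 2 + C E₁.a₂ * X 0 + C E₁.a₄) * (X 1 * (X 1 ^ 2 + C E₂.a₂ * X 1 + C E₂.a₄)))

/-- The branch polynomial of the twisted Legendre pencil, in the chart `z₂ = 1`. -/
def pencilBranch (ρ₁ ρ₂ : K) : MvPolynomial (Fin 2) K :=
  X 0 * (X 0 - 1) * (X 0 - X 1) * (X 1 ^ 2 + C (2 * ρ₁) * X 1 + C (ρ₂ ^ 2))

lemma onDoublePlane_kumBranch {E₁ E₂ : WeierstrassCurve K} {ε : K} {A : Type*} [CommRing A]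
    [Algebra K A] {p : Fin 3 → A} : OnDoublePlane (kumBranch E₁ E₂ ε) p ↔
      p 2 ^ 2 = algebraMap K A ε *
        (p 0 * (p 0 ^ 2 + algebraMap K A E₁.a₂ * p 0 + algebraMap K A E₁.a₄) *
          (p 1 * (p 1 ^ 2 + algebraMap K A E₂.a₂ * p 1 + algebraMap K A E₂.a₄))) := by
  simp [OnDoublePlane, kumBranch]

lemma onDoublePlane_pencilBranch {ρ₁ ρ₂ : K} {A : Type*} [CommRing A] [Algebra K A]
    {p : Fin 3 → A} : OnDoublePlane (pencilBranch ρ₁ ρ₂) p ↔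
      p 2 ^ 2 = p 0 * (p 0 - 1) * (p 0 - p 1) *
        (p 1 ^ 2 + 2 * algebraMap K A ρ₁ * p 1 + algebraMap K A ρ₂ ^ 2) := by
  simp [OnDoublePlane, pencilBranch, map_ofNat]

lemma X_sq_add_C_mul_X_add_C_ne_zero {R σ : Type*} [CommRing R] [Nontrivial R] (i : σ) (a b : R) :
    (X i ^ 2 + C a * X i + C b : MvPolynomial σ R) ≠ 0 := by
  intro h
  have h2 := congrArg (fun p => (aeval (fun _ => (Polynomial.X : Polynomial R)) p).coeff 2) h
  simp [algHom_C] at h2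

lemma odd_degreeOf_kumBranch (E₁ E₂ : WeierstrassCurve K) {ε : K} (hε : ε ≠ 0) :
    Odd (degreeOf 0 (kumBranch E₁ E₂ ε)) := by
  rw [← natDegree_finSuccEquiv]
  have hfac : finSuccEquiv K 1 (kumBranch E₁ E₂ ε) = Polynomial.X *
      (Polynomial.C 1 * Polynomial.X ^ 2 + Polynomial.C (C E₁.a₂) * Polynomial.X +
        Polynomial.C (C E₁.a₄)) *
      Polynomial.C (C ε * (X 0 * (X 0 ^ 2 + C E₂.a₂ * X 0 + C E₂.a₄))) := by
    have h1 : finSuccEquiv K 1 (X 1) = Polynomial.C (X 0) := finSuccEquiv_X_succ (j := 0)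
    have hC (r : K) : finSuccEquiv K 1 (C r) = Polynomial.C (C r) := by simp [finSuccEquiv_apply]
    simp only [kumBranch, map_mul, map_add, map_pow, finSuccEquiv_X_zero, h1, hC, map_one]
    ring
  have hconst : C ε * (X 0 * (X 0 ^ 2 + C E₂.a₂ * X 0 + C E₂.a₄)) ≠
      (0 : MvPolynomial (Fin 1) K) :=
    mul_ne_zero (by simpa using hε)
      (mul_ne_zero (X_ne_zero 0) (X_sq_add_C_mul_X_add_C_ne_zero _ _ _))
  have hdeg := Polynomial.natDegree_quadratic (R := MvPolynomial (Fin 1) K) (a := 1)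
    (b := C E₁.a₂) (c := C E₁.a₄) one_ne_zero
  have hquad := Polynomial.ne_zero_of_natDegree_gt (n := 1) (hdeg ▸ one_lt_two)
  rw [hfac, Polynomial.natDegree_mul_C hconst, Polynomial.natDegree_mul Polynomial.X_ne_zero hquad,
    hdeg, Polynomial.natDegree_X]
  decide

lemma odd_degreeOf_pencilBranch (ρ₁ ρ₂ : K) : Odd (degreeOf 0 (pencilBranch ρ₁ ρ₂)) := by
  rw [← natDegree_finSuccEquiv]
  have hfac : finSuccEquiv K 1 (pencilBranch ρ₁ ρ₂) = Polynomial.X *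
      (Polynomial.X - Polynomial.C 1) * (Polynomial.X - Polynomial.C (X 0)) *
      Polynomial.C (X 0 ^ 2 + C (2 * ρ₁) * X 0 + C (ρ₂ ^ 2)) := by
    have h1 : finSuccEquiv K 1 (X 1) = Polynomial.C (X 0) := finSuccEquiv_X_succ (j := 0)
    have hC (r : K) : finSuccEquiv K 1 (C r) = Polynomial.C (C r) := by simp [finSuccEquiv_apply]
    simp only [pencilBranch, map_mul, map_add, map_sub, map_pow, finSuccEquiv_X_zero, h1, hC,
      map_one]
  rw [hfac, Polynomial.natDegree_mul_C (X_sq_add_C_mul_X_add_C_ne_zero _ _ _),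
    Polynomial.natDegree_mul (mul_ne_zero Polynomial.X_ne_zero (Polynomial.X_sub_C_ne_zero _))
      (Polynomial.X_sub_C_ne_zero _),
    Polynomial.natDegree_mul Polynomial.X_ne_zero (Polynomial.X_sub_C_ne_zero _),
    Polynomial.natDegree_X, Polynomial.natDegree_X_sub_C, Polynomial.natDegree_X_sub_C]
  decide

lemma affineCoord_doubleQuadricIdeal_zero (E₁ E₂ : WeierstrassCurve K) (ε : K) :
    affineCoord (doubleQuadricIdeal E₁ E₂ ε) 3 rfl 0 =
      affineCoord (doubleQuadricIdeal E₁ E₂ ε) 3 rfl 1 *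
        affineCoord (doubleQuadricIdeal E₁ E₂ ε) 3 rfl 2 := by
  have hquadric : aeval (affineCoord (doubleQuadricIdeal E₁ E₂ ε) 3 rfl)
      (X 0 * X 3 - X 1 * X 2 : MvPolynomial (Fin 5) K) = 0 :=
    ChartRing.aeval_affineCoord_eq_zero_of_mem 3 rfl (Or.inl rfl)
  have h3 : affineCoord (doubleQuadricIdeal E₁ E₂ ε) 3 rfl 3 = 1 :=
    ChartRing.affineCoord_self _ 3 rfl
  simp only [map_sub, map_mul, aeval_X, h3, mul_one] at hquadric
  exact sub_eq_zero.1 hquadric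

lemma isDoublePlaneRing_doubleQuadric (E₁ E₂ : WeierstrassCurve K) (ε : K) :
    IsDoublePlaneRing (kumBranch E₁ E₂ ε)
      (affineCoord (doubleQuadricIdeal E₁ E₂ ε) 3 rfl ∘ ![1, 2, 4]) where
  mem := by
    have hquartic : aeval (affineCoord (doubleQuadricIdeal E₁ E₂ ε) 3 rfl)
        (X 4 ^ 2 - C ε * branchForm E₁ E₂) = 0 :=
      ChartRing.aeval_affineCoord_eq_zero_of_mem 3 rfl (Or.inr rfl)
    have h3 : affineCoord (doubleQuadricIdeal E₁ E₂ ε) 3 rfl 3 = 1 :=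
      ChartRing.affineCoord_self _ 3 rfl
    simp only [branchForm, map_sub, map_mul, map_add, map_pow, aeval_X, algHom_C,
      h3, affineCoord_doubleQuadricIdeal_zero] at hquartic
    rw [onDoublePlane_kumBranch]
    simp only [Function.comp_apply, Matrix.cons_val]
    linear_combination hquartic
  gen := by
    rw [← top_le_iff, ← ChartRing.adjoin_affineCoord _ 3 rfl, Algebra.adjoin_le_iff]
    set x := affineCoord (doubleQuadricIdeal E₁ E₂ ε) 3 rfl
    have hmem (j : Fin 3) : x (![1, 2, 4] j) ∈ Algebra.adjoin K (Set.range (x ∘ ![1, 2, 4])) :=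
      Algebra.subset_adjoin ⟨j, rfl⟩
    have h0 : x 0 = x 1 * x 2 := affineCoord_doubleQuadricIdeal_zero E₁ E₂ ε
    have h3 : x 3 = 1 := ChartRing.affineCoord_self _ 3 rfl
    rintro _ ⟨j, rfl⟩
    fin_cases j
    · exact h0 ▸ mul_mem (hmem 0) (hmem 1)
    · exact hmem 0
    · exact hmem 1
    · exact h3 ▸ one_mem _
    · exact hmem 2
  lift L _ _ p hp := by
    rw [onDoublePlane_kumBranch] at hp
    obtain ⟨ψ, hψ⟩ : ∃ ψ : ChartRing (doubleQuadricIdeal E₁ E₂ ε) 3 →ₐ[K] L,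
        ∀ j, ψ (affineCoord (doubleQuadricIdeal E₁ E₂ ε) 3 rfl j) =
          ![p 0 * p 1, p 0, p 1, 1, p 2] j := by
      refine ChartRing.exists_algHom_idealOf 3 rfl _ ?_ rfl
      rintro q (rfl | rfl)
      · simp
      · simp only [branchForm, map_sub, map_mul, map_add, map_pow, aeval_X, algHom_C,
          Matrix.cons_val]
        linear_combination hp
    refine ⟨ψ, fun j => (hψ _).trans ?_⟩
    fin_cases j <;> rfl

lemma isDoublePlaneRing_legendrePencil (ρ₁ ρ₂ : K) :
    IsDoublePlaneRing (pencilBranch ρ₁ ρ₂)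
      (affineCoord (legendrePencilIdeal ρ₁ ρ₂) 1 rfl ∘ ![0, 2, 3]) where
  mem := by
    have hsextic : aeval (affineCoord (legendrePencilIdeal ρ₁ ρ₂) 1 rfl)
        (X 3 ^ 2 - X 0 * X 1 * (X 0 - X 1) * (X 0 - X 2) *
          (X 2 ^ 2 + C (2 * ρ₁) * (X 1 * X 2) + C (ρ₂ ^ 2) * X 1 ^ 2)) = 0 :=
      ChartRing.aeval_affineCoord_eq_zero_of_mem 1 rfl rfl
    have h1 : affineCoord (legendrePencilIdeal ρ₁ ρ₂) 1 rfl 1 = 1 :=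
      ChartRing.affineCoord_self _ 1 rfl
    simp only [map_sub, map_mul, map_add, map_pow, aeval_X, algHom_C, map_ofNat,
      h1] at hsextic
    rw [onDoublePlane_pencilBranch]
    simp only [Function.comp_apply, Matrix.cons_val]
    linear_combination hsextic
  gen := by
    rw [← top_le_iff, ← ChartRing.adjoin_affineCoord _ 1 rfl, Algebra.adjoin_le_iff]
    set x := affineCoord (legendrePencilIdeal ρ₁ ρ₂) 1 rfl
    have hmem (j : Fin 3) : x (![0, 2, 3] j) ∈ Algebra.adjoin K (Set.range (x ∘ ![0, 2, 3])) :=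
      Algebra.subset_adjoin ⟨j, rfl⟩
    have h1 : x 1 = 1 := ChartRing.affineCoord_self _ 1 rfl
    rintro _ ⟨j, rfl⟩
    fin_cases j
    · exact hmem 0
    · exact h1 ▸ one_mem _
    · exact hmem 1
    · exact hmem 2
  lift L _ _ p hp := by
    rw [onDoublePlane_pencilBranch] at hp
    obtain ⟨ψ, hψ⟩ : ∃ ψ : ChartRing (legendrePencilIdeal ρ₁ ρ₂) 1 →ₐ[K] L,
        ∀ j, ψ (affineCoord (legendrePencilIdeal ρ₁ ρ₂) 1 rfl j) = ![p 0, 1, p 1, p 2] j := by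
      refine ChartRing.exists_algHom_idealOf 1 rfl _ ?_ rfl
      rintro q rfl
      simp only [map_sub, map_mul, map_add, map_pow, aeval_X, algHom_C, Matrix.cons_val, map_ofNat]
      linear_combination hp
    refine ⟨ψ, fun j => (hψ _).trans ?_⟩
    fin_cases j <;> rfl

lemma comp_vec_three {α β : Type*} (f : α → β) (a b c : α) : f ∘ ![a, b, c] = ![f a, f b, f c] := by
  ext i
  fin_cases i <;> rfl

lemma Kum.isDoublePlaneField {E₁ E₂ : WeierstrassCurve K} {ε : K} (hε : ε ≠ 0) (S : Kum E₁ E₂ ε) :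
    IsDoublePlaneField (kumBranch E₁ E₂ ε) (Kum.coords S) := by
  have h := MinimalResolution.isDoublePlaneField S rfl (isDoublePlaneRing_doubleQuadric E₁ E₂ ε)
    (odd_degreeOf_kumBranch E₁ E₂ hε)
  rwa [comp_vec_three] at h

lemma LegendreK3.isDoublePlaneField {ρ₁ ρ₂ : K} (S : LegendreK3 ρ₁ ρ₂) :
    IsDoublePlaneField (pencilBranch ρ₁ ρ₂) (LegendreK3.coords S) := by
  have h := MinimalResolution.isDoublePlaneField S rfl (isDoublePlaneRing_legendrePencil ρ₁ ρ₂)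
    (odd_degreeOf_pencilBranch ρ₁ ρ₂)
  rwa [comp_vec_three] at h

end Models

section Families

variable {K : Type u} [Field K] [CharZero K] {κ₁ κ₂ : K}

lemma evalFamily_ne_zero_of_algebraicIndependent {F : Type u} [Field F] [Algebra K F] {x t : F}
    (h : AlgebraicIndependent K ![x, t]) {P : MvPolynomial (Fin 5) ℚ} (v w : K)
    (hP : evalFamily κ₁ κ₂ ![v, w, 0] P ≠ 0) : evalFamily κ₁ κ₂ ![x, t, 0] P ≠ 0 := by
  let Q : MvPolynomial (Fin 2) K :=
    P.eval₂ (C.comp (algebraMap ℚ K)) ![C κ₁, C κ₂, X 0, X 1, 0]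
  have hQ {L : Type u} [Field L] [Algebra K L] (y s : L) :
      aeval ![y, s] Q = evalFamily κ₁ κ₂ ![y, s, 0] P := by
    refine (eval₂_comp_left (aeval ![y, s]).toRingHom _ _ _).trans (congrArg₂ (eval₂ · · P) ?_ ?_)
    · exact Subsingleton.elim _ _
    · ext i
      fin_cases i <;> simp
  rw [← hQ] at hP ⊢
  exact aeval_ne_zero_of_eval_ne_zero h ![v, w] (by rwa [← coe_aeval_eq_eval])

/-- The quotients `Nᵢ / Dᵢ` at `p` are the coordinates `r` of a point of `y² = g(x₀, x₁)` for which
`dr₀ ∧ dr₁ / r₂ = dp₀ ∧ dp₁ / p₂`; here `J` is the Jacobian of `(r₀, r₁)` in `(p₀, p₁)`. -/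
def PreservesForm {F : Type u} [Field F] [Algebra K F] (κ₁ κ₂ : K)
    (N D : Fin 3 → MvPolynomial (Fin 5) ℚ) (g : MvPolynomial (Fin 2) K) (p : Fin 3 → F) : Prop :=
  ∃ (r : Fin 3 → F) (J : F), J ≠ 0 ∧
    (∀ i, evalFamily κ₁ κ₂ p (D i) ≠ 0 ∧
      evalFamily κ₁ κ₂ p (N i) / evalFamily κ₁ κ₂ p (D i) = r i) ∧
    OnDoublePlane g r ∧ r 2 = J * p 2 ∧ wedge K (r 0) (r 1) = J • wedge K (p 0) (p 1)

variable {Z Z' : Scheme.{u}} {z : Z ⟶ Spec (.of K)} {z' : Z' ⟶ Spec (.of K)}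
  {S : MinimalResolution z} {T : MinimalResolution z'} {f g : MvPolynomial (Fin 2) K}
  {p : Fin 3 → S.FunctionField} {q : Fin 3 → T.FunctionField}

lemma exists_dominantMap_of_preservesForm (hp : IsDoublePlaneField f p)
    (hq : IsDoublePlaneField g q) {N D : Fin 3 → MvPolynomial (Fin 5) ℚ}
    (h : PreservesForm κ₁ κ₂ N D g p) :
    ∃ φ : DominantMap S T, φ.GivenBy κ₁ κ₂ p q N D ∧
      φ.pullback (natForm K (q 0) (q 1) (q 2)) = natForm K (p 0) (p 1) (p 2) := by
  obtain ⟨r, J, hJ, hND, hr, hrJ, hwedge⟩ := h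
  have hindep : AlgebraicIndependent K ![r 0, r 1] := by
    rw [← wedge_ne_zero_iff_algebraicIndependent, hwedge]
    exact smul_ne_zero hJ (wedge_ne_zero_iff_algebraicIndependent.2 hp.indep)
  obtain ⟨ψ, hψ⟩ := hq.lift _ r hr hindep
  obtain ⟨φ, rfl⟩ := exists_dominantMap_comap_eq ψ
  refine ⟨φ, fun i => ⟨(hND i).1, (hψ i).trans (hND i).2.symm⟩, ?_⟩
  rw [← natForm_eq_of_wedge_eq_smul hJ hwedge, ← hrJ, ← hψ, ← hψ, ← hψ]
  exact (pullbackTwoForm_smul_ι φ.comap _ _ _).trans (by rw [map_inv₀]; rfl)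

end Families

section Formulas

variable {F : Type u} [Field F]

lemma pencil_quadratic_eq {a b l₁ l₂ r₁ r₂ : F} (hl₁ : l₁ * (1 - a) = 1) (hl₂ : l₂ * (1 - b) = 1)
    (hr₁ : r₁ = l₁ + l₂ - 2 * l₁ * l₂ - 1) (hr₂ : r₂ ^ 2 = (1 - l₁ - l₂) ^ 2) (t : F) :
    t ^ 2 + 2 * r₁ * t + r₂ ^ 2 =
      (((1 - a) * (1 - b) * t - (1 + a * b)) ^ 2 - 4 * a * b) / ((1 - a) * (1 - b)) ^ 2 := by
  have he₁ : 1 - a ≠ 0 := right_ne_zero_of_mul_eq_one hl₁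
  have he₂ : 1 - b ≠ 0 := right_ne_zero_of_mul_eq_one hl₂
  rw [hr₂, hr₁, eq_one_div_of_mul_eq_one_left hl₁, eq_one_div_of_mul_eq_one_left hl₂]
  field_simp
  ring

lemma legendre_cubic_eq {a l : F} (hl : l * (1 - a) = 1) (x : F) :
    x * (x ^ 2 + -(1 + l) * x + l) = x * (1 - x) * (1 - (1 - a) * x) / (1 - a) := by
  have he : 1 - a ≠ 0 := right_ne_zero_of_mul_eq_one hl
  rw [eq_one_div_of_mul_eq_one_left hl]
  field_simp
  ring

lemma pencil_equation_of_kum {a b x₁ x₂ w₁ w₂ u x t : F} (he₁ : 1 - a ≠ 0) (he₂ : 1 - b ≠ 0)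
    (hw₁ : w₁ = 1 - (1 - a) * x₁) (hw₂ : w₂ = 1 - (1 - b) * x₂) (hu : u = w₁ / w₂) (hx₁ : x₁ ≠ 0)
    (hw₁0 : w₁ ≠ 0) (hw₂0 : w₂ ≠ 0) (hx : x = x₂ / x₁ * (1 - b * u) / (1 - a))
    (ht : t = (u - a) * (1 - b * u) / ((1 - a) * (1 - b) * u)) :
    ((b * u ^ 2 - a) * (1 - b * u) * (u - 1) /
        ((1 - a) ^ 2 * (1 - b) * u ^ 2 * x₁ ^ 2 * w₂)) ^ 2 *
      ((x₁ * (1 - x₁) * w₁ / (1 - a)) * (x₂ * (1 - x₂) * w₂ / (1 - b))) =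
      x * (x - 1) * (x - t) *
        ((((1 - a) * (1 - b) * t - (1 + a * b)) ^ 2 - 4 * a * b) / ((1 - a) * (1 - b)) ^ 2) := by
  have hu0 : u ≠ 0 := hu ▸ div_ne_zero hw₁0 hw₂0
  have hwu : w₁ = u * w₂ := by rw [hu, div_mul_cancel₀ _ hw₂0]
  have hx₁w : (1 - a) * x₁ = 1 - u * w₂ := by rw [← hwu, hw₁]; ring
  have hsub_one : x - 1 = (1 - x₂) * (u - 1) / ((1 - a) * x₁) := by
    rw [hx]
    field_simp
    linear_combination u * hw₂ - hx₁w
  have hsub : x - t = (1 - b * u) * (1 - x₁) * (u - 1) / ((1 - a) * (1 - b) * x₁ * u) := by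
    rw [hx, ht]
    field_simp
    linear_combination (1 - b * u) * (u * hw₂ - hx₁w)
  have hquadratic : ((1 - a) * (1 - b) * t - (1 + a * b)) ^ 2 - 4 * a * b =
      ((b * u ^ 2 - a) / u) ^ 2 := by
    rw [ht]
    field_simp
    ring
  rw [hquadratic, hsub, hsub_one, hx, hwu]
  field_simp

lemma legendre_cubic_isogeny [CharZero F] {s : F} (hs : s ≠ 0) (l : F) :
    (s + 1) ^ 2 / (4 * s) * (((s + 1) ^ 2 / (4 * s)) ^ 2 + -(1 + l) * ((s + 1) ^ 2 / (4 * s)) + l) =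
      ((s ^ 2 - 1) / (4 * s ^ 2)) ^ 2 * (s * (s ^ 2 + 2 * (1 - 2 * l) * s + 1)) / 4 := by
  field_simp
  ring

lemma pencil_fibre_isogeny {x t : F} (hxt : x - t ≠ 0) :
    (x * (x - 1) / (x - t)) ^ 2 + 2 * (1 - 2 * t) * (x * (x - 1) / (x - t)) + 1 =
      ((x ^ 2 - 2 * t * x + t) / (x - t)) ^ 2 := by
  field_simp
  ring

lemma isogenous_equation {a k l₁ l₂ s t c N D g : F} (hl₁ : l₁ * (1 - a) = 1)
    (hl₂ : l₂ * (1 - k ^ 2) = 1) (hc : c = (1 - a) * (1 - k ^ 2) * t - (1 + a * k ^ 2))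
    (hN : N = (1 + k) * (c + k * (1 + a)) * s - k * (1 - k) * (1 - a))
    (hD : D = k * (1 + k) * (1 - a) * s + (1 - k) * (c - k * (1 + a)))
    (hg : g = (1 - a) * (1 + k) ^ 2 * s ^ 2 - 2 * (1 + a) * (1 - k ^ 2) * s + (1 - a) * (1 - k) ^ 2)
    (hN0 : N ≠ 0) (hD0 : D ≠ 0) :
    N / D * ((N / D) ^ 2 + 2 * (1 - 2 * l₁) * (N / D) + 1) *
        (s * D / N * ((s * D / N) ^ 2 + 2 * (1 - 2 * l₂) * (s * D / N) + 1)) =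
      (k * g / (N * D)) ^ 2 * (s * (s ^ 2 + 2 * (1 - 2 * t) * s + 1)) *
        (c ^ 2 - 4 * a * k ^ 2) := by
  have he₁ : 1 - a ≠ 0 := right_ne_zero_of_mul_eq_one hl₁
  have he₂ : 1 - k ^ 2 ≠ 0 := right_ne_zero_of_mul_eq_one hl₂
  have hmobius : (1 - a) * N ^ 2 - 2 * (1 + a) * (N * D) + (1 - a) * D ^ 2 =
      (c ^ 2 - 4 * a * k ^ 2) * g := by
    rw [hN, hD, hg]
    ring
  have hfirst : (N / D) ^ 2 + 2 * (1 - 2 * l₁) * (N / D) + 1 =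
      (c ^ 2 - 4 * a * k ^ 2) * g / ((1 - a) * D ^ 2) := by
    rw [← hmobius, eq_one_div_of_mul_eq_one_left hl₁]
    field_simp
    ring
  have hfactor : (1 + k) * s * D - (1 - k) * N = k * g := by
    rw [hN, hD, hg]
    ring
  have hfactor' : (1 - k) * s * D - (1 + k) * N =
      k * (1 - a) * (1 - k ^ 2) * (s ^ 2 + 2 * (1 - 2 * t) * s + 1) := by
    rw [hN, hD, hc]
    ring
  have hsecond : (s * D / N) ^ 2 + 2 * (1 - 2 * l₂) * (s * D / N) + 1 =
      k * g * (k * (1 - a) * (1 - k ^ 2) * (s ^ 2 + 2 * (1 - 2 * t) * s + 1)) /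
        ((1 - k ^ 2) * N ^ 2) := by
    rw [← hfactor, ← hfactor', eq_one_div_of_mul_eq_one_left hl₂]
    field_simp
    ring
  rw [hfirst, hsecond]
  field_simp

variable {K : Type u} [Field K] [Algebra K F]

lemma wedge_kum_ratios {a b x₁ x₂ w₁ w₂ : F} (ha : KaehlerDifferential.D K F a = 0)
    (hb : KaehlerDifferential.D K F b = 0) (hw₁ : w₁ = 1 - (1 - a) * x₁)
    (hw₂ : w₂ = 1 - (1 - b) * x₂) (hx₁ : x₁ ≠ 0) (hw₂0 : w₂ ≠ 0) :
    wedge K (x₂ / x₁) (w₁ / w₂) = ((1 - w₁ / w₂) / (x₁ ^ 2 * w₂)) • wedge K x₁ x₂ := by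
  have hq : KaehlerDifferential.D K F (x₂ / x₁) =
      (-x₂ / x₁ ^ 2) • KaehlerDifferential.D K F x₁ +
        (1 / x₁) • KaehlerDifferential.D K F x₂ := by
    simp only [Derivation.leibniz_div]
    match_scalars <;> field_simp
  have hu : KaehlerDifferential.D K F (w₁ / w₂) =
      (-(1 - a) / w₂) • KaehlerDifferential.D K F x₁ +
        ((1 - b) * w₁ / w₂ ^ 2) • KaehlerDifferential.D K F x₂ := by
    have h₁ : KaehlerDifferential.D K F w₁ = -((1 - a) • KaehlerDifferential.D K F x₁) := by
      simp [hw₁, ha]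
    have h₂ : KaehlerDifferential.D K F w₂ = -((1 - b) • KaehlerDifferential.D K F x₂) := by
      simp [hw₂, hb]
    rw [Derivation.leibniz_div, h₁, h₂]
    match_scalars <;> field_simp
  rw [wedge_eq_smul_wedge hq hu]
  congr 1
  field_simp
  linear_combination w₂ * hw₁ - w₁ * hw₂

lemma wedge_pencil_of_ratios {a b q u : F} (ha : KaehlerDifferential.D K F a = 0)
    (hb : KaehlerDifferential.D K F b = 0) (he₁ : 1 - a ≠ 0) (he₂ : 1 - b ≠ 0) (hu : u ≠ 0) :
    wedge K (q * (1 - b * u) / (1 - a)) ((u - a) * (1 - b * u) / ((1 - a) * (1 - b) * u)) =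
      ((1 - b * u) / (1 - a) * (-(b * u ^ 2 - a) / ((1 - a) * (1 - b) * u ^ 2))) •
        wedge K q u := by
  have hx : KaehlerDifferential.D K F (q * (1 - b * u) / (1 - a)) =
      ((1 - b * u) / (1 - a)) • KaehlerDifferential.D K F q +
        (-(q * b) / (1 - a)) • KaehlerDifferential.D K F u := by
    simp only [Derivation.leibniz_div, Derivation.leibniz, map_sub, Derivation.map_one_eq_zero,
      ha, hb]
    match_scalars <;> field_simp
  have ht : KaehlerDifferential.D K F ((u - a) * (1 - b * u) / ((1 - a) * (1 - b) * u)) =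
      (0 : F) • KaehlerDifferential.D K F q +
        (-(b * u ^ 2 - a) / ((1 - a) * (1 - b) * u ^ 2)) • KaehlerDifferential.D K F u := by
    simp only [Derivation.leibniz_div, Derivation.leibniz, map_sub, Derivation.map_one_eq_zero,
      ha, hb]
    match_scalars
    · field_simp
      ring
    · simp
  rw [wedge_eq_smul_wedge hx ht, mul_zero, sub_zero]

lemma wedge_pencil_of_kum {a b x₁ x₂ w₁ w₂ u : F} (ha : KaehlerDifferential.D K F a = 0)
    (hb : KaehlerDifferential.D K F b = 0) (he₁ : 1 - a ≠ 0) (he₂ : 1 - b ≠ 0)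
    (hw₁ : w₁ = 1 - (1 - a) * x₁) (hw₂ : w₂ = 1 - (1 - b) * x₂) (hu : u = w₁ / w₂)
    (hx₁ : x₁ ≠ 0) (hw₁0 : w₁ ≠ 0) (hw₂0 : w₂ ≠ 0) :
    wedge K (x₂ / x₁ * (1 - b * u) / (1 - a))
        ((u - a) * (1 - b * u) / ((1 - a) * (1 - b) * u)) =
      ((b * u ^ 2 - a) * (1 - b * u) * (u - 1) /
        ((1 - a) ^ 2 * (1 - b) * u ^ 2 * x₁ ^ 2 * w₂)) • wedge K x₁ x₂ := by
  have hu0 : u ≠ 0 := hu ▸ div_ne_zero hw₁0 hw₂0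
  have hratios : wedge K (x₂ / x₁) u = ((1 - u) / (x₁ ^ 2 * w₂)) • wedge K x₁ x₂ :=
    hu ▸ wedge_kum_ratios ha hb hw₁ hw₂ hx₁ hw₂0
  rw [wedge_pencil_of_ratios ha hb he₁ he₂ hu0, hratios, smul_smul]
  congr 1
  field_simp
  ring

lemma wedge_pencil_fibre {x t : F} (hxt : x - t ≠ 0) :
    wedge K (x * (x - 1) / (x - t)) t =
      ((x ^ 2 - 2 * t * x + t) / (x - t) ^ 2) • wedge K x t := by
  have hs : KaehlerDifferential.D K F (x * (x - 1) / (x - t)) =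
      ((x ^ 2 - 2 * t * x + t) / (x - t) ^ 2) • KaehlerDifferential.D K F x +
        (x * (x - 1) / (x - t) ^ 2) • KaehlerDifferential.D K F t := by
    simp only [Derivation.leibniz_div, Derivation.leibniz, map_sub, Derivation.map_one_eq_zero]
    match_scalars <;> field_simp
    ring
  rw [wedge_eq_smul_wedge hs (c := 0) (d := 1) (by module), mul_one, mul_zero, sub_zero]

lemma wedge_div_right {r s : F} (hr : r ≠ 0) : wedge K r (s / r) = (1 / r) • wedge K r s := by
  have hs : KaehlerDifferential.D K F (s / r) =
      (-s / r ^ 2) • KaehlerDifferential.D K F r + (1 / r) • KaehlerDifferential.D K F s := by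
    rw [Derivation.leibniz_div]
    match_scalars <;> field_simp
  rw [wedge_eq_smul_wedge (a := 1) (b := 0) (by module) hs, one_mul, zero_mul, sub_zero]

lemma wedge_isogenous_of_fibre {a k s t c N D g : F} (ha : KaehlerDifferential.D K F a = 0)
    (hk : KaehlerDifferential.D K F k = 0)
    (hc : c = (1 - a) * (1 - k ^ 2) * t - (1 + a * k ^ 2))
    (hN : N = (1 + k) * (c + k * (1 + a)) * s - k * (1 - k) * (1 - a))
    (hD : D = k * (1 + k) * (1 - a) * s + (1 - k) * (c - k * (1 + a)))
    (hg : g = (1 - a) * (1 + k) ^ 2 * s ^ 2 - 2 * (1 + a) * (1 - k ^ 2) * s + (1 - a) * (1 - k) ^ 2)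
    (hN0 : N ≠ 0) (hD0 : D ≠ 0) :
    wedge K (N / D) (s * D / N) =
      (-(k * (1 - a) * (1 - k ^ 2) * g / (N * D))) • wedge K s t := by
  have hdc : KaehlerDifferential.D K F c =
      ((1 - a) * (1 - k ^ 2)) • KaehlerDifferential.D K F t := by
    simp [hc, ha, hk]
  have hdN : KaehlerDifferential.D K F N =
      ((1 + k) * (c + k * (1 + a))) • KaehlerDifferential.D K F s +
        ((1 + k) * s * ((1 - a) * (1 - k ^ 2))) • KaehlerDifferential.D K F t := by
    simp only [hN, map_add, map_sub, Derivation.leibniz, Derivation.map_one_eq_zero, ha, hk, hdc]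
    match_scalars <;> ring
  have hdD : KaehlerDifferential.D K F D =
      (k * (1 + k) * (1 - a)) • KaehlerDifferential.D K F s +
        ((1 - k) * ((1 - a) * (1 - k ^ 2))) • KaehlerDifferential.D K F t := by
    simp only [hD, map_add, map_sub, Derivation.leibniz, Derivation.map_one_eq_zero, ha, hk, hdc]
    match_scalars <;> ring
  have hdr : KaehlerDifferential.D K F (N / D) =
      (((1 + k) * (c + k * (1 + a)) * D - k * (1 + k) * (1 - a) * N) / D ^ 2) •
          KaehlerDifferential.D K F s +
        ((1 - a) * (1 - k ^ 2) * (k * g) / D ^ 2) • KaehlerDifferential.D K F t := by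
    have hfactor : (1 + k) * s * D - (1 - k) * N = k * g := by
      rw [hN, hD, hg]
      ring
    rw [Derivation.leibniz_div, hdN, hdD, ← hfactor]
    match_scalars <;> field_simp
  rw [← div_div_eq_mul_div, wedge_div_right (div_ne_zero hN0 hD0),
    wedge_eq_smul_wedge hdr (c := 1) (d := 0) (by module), smul_smul]
  congr 1
  field_simp
  ring

lemma D_two_isogeny [CharZero F] {s : F} (hs : s ≠ 0) :
    KaehlerDifferential.D K F ((s + 1) ^ 2 / (4 * s)) =
      ((s ^ 2 - 1) / (4 * s ^ 2)) • KaehlerDifferential.D K F s := by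
  have h4 : KaehlerDifferential.D K F 4 = 0 := by
    exact_mod_cast (KaehlerDifferential.D K F).map_natCast 4
  simp only [Derivation.leibniz_div, Derivation.leibniz_pow, Derivation.leibniz, map_add,
    Derivation.map_one_eq_zero, h4]
  match_scalars
  field_simp
  ring

lemma wedge_two_isogeny [CharZero F] {s t : F} (hs : s ≠ 0) (ht : t ≠ 0) :
    wedge K ((s + 1) ^ 2 / (4 * s)) ((t + 1) ^ 2 / (4 * t)) =
      ((s ^ 2 - 1) / (4 * s ^ 2) * ((t ^ 2 - 1) / (4 * t ^ 2))) • wedge K s t := by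
  simpa using wedge_eq_smul_wedge (x := s) (t := t) (a := (s ^ 2 - 1) / (4 * s ^ 2)) (b := 0)
    (c := 0) (d := (t ^ 2 - 1) / (4 * t ^ 2)) (by simp [D_two_isogeny hs])
    (by simp [D_two_isogeny ht])

end Formulas

section Maps

/-- The numerator of the Jacobian factor of the map from the Kummer surface to the twisted Legendre
pencil; `wₗ = 1 - xₗ / Λₗ`. -/
def kumToPencilJacobian : MvPolynomial (Fin 5) ℚ :=
  let w₁ := 1 - (1 - X 0 ^ 2) * X 2
  let w₂ := 1 - (1 - X 1 ^ 2) * X 3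
  (X 1 ^ 2 * w₁ ^ 2 - X 0 ^ 2 * w₂ ^ 2) * (w₂ - X 1 ^ 2 * w₁) * (w₁ - w₂)

/-- Numerators of the map from the Kummer surface to the twisted Legendre pencil. -/
def kumToPencilNum : Fin 3 → MvPolynomial (Fin 5) ℚ :=
  let w₁ := 1 - (1 - X 0 ^ 2) * X 2
  let w₂ := 1 - (1 - X 1 ^ 2) * X 3
  ![X 3 * (w₂ - X 1 ^ 2 * w₁), (w₁ - X 0 ^ 2 * w₂) * (w₂ - X 1 ^ 2 * w₁),
    kumToPencilJacobian * X 4]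

/-- Denominators of the map from the Kummer surface to the twisted Legendre pencil. -/
def kumToPencilDen : Fin 3 → MvPolynomial (Fin 5) ℚ :=
  let e₁ := 1 - X 0 ^ 2
  let e₂ := 1 - X 1 ^ 2
  let w₁ := 1 - e₁ * X 2
  let w₂ := 1 - e₂ * X 3
  ![e₁ * X 2 * w₂, e₁ * e₂ * w₁ * w₂, e₁ ^ 2 * e₂ * X 2 ^ 2 * w₁ ^ 2 * w₂ ^ 3]

/-- Numerators of the map `xᵢ ↦ (xᵢ + 1)² / (4 xᵢ)` of Kummer surfaces. -/
def isogenousToKumNum : Fin 3 → MvPolynomial (Fin 5) ℚ :=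
  ![(X 2 + 1) ^ 2, (X 3 + 1) ^ 2, (X 2 ^ 2 - 1) * (X 3 ^ 2 - 1) * X 4]

/-- Denominators of the map `xᵢ ↦ (xᵢ + 1)² / (4 xᵢ)` of Kummer surfaces. -/
def isogenousToKumDen : Fin 3 → MvPolynomial (Fin 5) ℚ :=
  ![4 * X 2, 4 * X 3, 16 * X 2 ^ 2 * X 3 ^ 2]

/-- Numerator of the first coordinate `r` of the map from the pencil `(x, t)` to the isogenous
Kummer surface. With `s = x (x - 1) / (x - t)`, `r` is a Möbius transform of `s` with coefficients
in `ℚ(κ₁, κ₂, t)`, and the second coordinate is `s / r`; here `P / Q = s (1 + κ₂) / (1 - κ₂)`. -/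
def pencilMobiusNum : MvPolynomial (Fin 5) ℚ :=
  let e₁ := 1 - X 0 ^ 2
  let P := X 2 * (X 2 - 1) * (1 + X 1)
  let Q := (X 2 - X 3) * (1 - X 1)
  (e₁ * (1 - X 1 ^ 2) * X 3 - (1 + X 0 ^ 2 * X 1 ^ 2)) * P + X 1 * ((1 + X 0 ^ 2) * P - e₁ * Q)

/-- Denominator of the Möbius transform whose numerator is `pencilMobiusNum`. -/
def pencilMobiusDen : MvPolynomial (Fin 5) ℚ :=
  let e₁ := 1 - X 0 ^ 2
  let P := X 2 * (X 2 - 1) * (1 + X 1)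
  let Q := (X 2 - X 3) * (1 - X 1)
  (e₁ * (1 - X 1 ^ 2) * X 3 - (1 + X 0 ^ 2 * X 1 ^ 2)) * Q + X 1 * (e₁ * P - (1 + X 0 ^ 2) * Q)

/-- The quadratic form in `P` and `Q` whose product with `κ₂` is
`P * pencilMobiusDen - Q * pencilMobiusNum`. -/
def pencilQuadratic : MvPolynomial (Fin 5) ℚ :=
  let e₁ := 1 - X 0 ^ 2
  let P := X 2 * (X 2 - 1) * (1 + X 1)
  let Q := (X 2 - X 3) * (1 - X 1)
  e₁ * P ^ 2 - 2 * (1 + X 0 ^ 2) * P * Q + e₁ * Q ^ 2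

/-- Numerators of the map from the twisted Legendre pencil to the isogenous Kummer surface. -/
def pencilToIsogenousNum : Fin 3 → MvPolynomial (Fin 5) ℚ :=
  ![pencilMobiusNum, X 2 * (X 2 - 1) * pencilMobiusDen,
    -(X 1 * (1 - X 0 ^ 2) * (1 - X 1 ^ 2) * pencilQuadratic *
      (X 2 ^ 2 - 2 * X 3 * X 2 + X 3) * X 4)]

/-- Denominators of the map from the twisted Legendre pencil to the isogenous Kummer surface. -/
def pencilToIsogenousDen : Fin 3 → MvPolynomial (Fin 5) ℚ :=
  ![pencilMobiusDen, (X 2 - X 3) * pencilMobiusNum,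
    (X 2 - X 3) ^ 2 * pencilMobiusNum * pencilMobiusDen]

variable {K : Type u} [Field K] {κ₁ κ₂ Λ₁ Λ₂ ρ₁ ρ₂ : K} {F : Type u} [Field F] [Algebra K F]
  {p : Fin 3 → F}

lemma onDoublePlane_kumBranch_legendreCurve {ε : K} :
    OnDoublePlane (kumBranch (legendreCurve Λ₁) (legendreCurve Λ₂) ε) p ↔
      p 2 ^ 2 = algebraMap K F ε *
        (p 0 * (p 0 ^ 2 + -(1 + algebraMap K F Λ₁) * p 0 + algebraMap K F Λ₁) *
          (p 1 * (p 1 ^ 2 + -(1 + algebraMap K F Λ₂) * p 1 + algebraMap K F Λ₂))) := by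
  rw [onDoublePlane_kumBranch]
  simp only [legendreCurve, map_neg, map_add, map_one]

lemma onDoublePlane_kumBranch_isogenousCurve {ε : K} :
    OnDoublePlane (kumBranch (isogenousCurve Λ₁) (isogenousCurve Λ₂) ε) p ↔
      p 2 ^ 2 = algebraMap K F ε *
        (p 0 * (p 0 ^ 2 + 2 * (1 - 2 * algebraMap K F Λ₁) * p 0 + 1) *
          (p 1 * (p 1 ^ 2 + 2 * (1 - 2 * algebraMap K F Λ₂) * p 1 + 1))) := by
  rw [onDoublePlane_kumBranch]
  simp only [isogenousCurve, map_mul, map_sub, map_one, map_ofNat]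

variable [CharZero K]

lemma preservesForm_isogenousToKum
    (hp : IsDoublePlaneField (kumBranch (isogenousCurve Λ₁) (isogenousCurve Λ₂) 1) p) :
    PreservesForm κ₁ κ₂ isogenousToKumNum isogenousToKumDen
      (kumBranch (legendreCurve Λ₁) (legendreCurve Λ₂) (2 ^ 4)) p := by
  have : CharZero F := charZero_of_injective_algebraMap (algebraMap K F).injective
  have hden : evalFamily κ₁ κ₂ ![p 0, p 1, 0] (X 2 * X 3) ≠ 0 :=
    evalFamily_ne_zero_of_algebraicIndependent hp.indep 1 1 (by simp [evalFamily])
  have hnum : evalFamily κ₁ κ₂ ![p 0, p 1, 0] ((X 2 ^ 2 - 1) * (X 3 ^ 2 - 1)) ≠ 0 :=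
    evalFamily_ne_zero_of_algebraicIndependent hp.indep 0 0 (by simp [evalFamily])
  obtain ⟨hp₀, hp₁⟩ : p 0 ≠ 0 ∧ p 1 ≠ 0 := by simpa [evalFamily] using hden
  refine ⟨![(p 0 + 1) ^ 2 / (4 * p 0), (p 1 + 1) ^ 2 / (4 * p 1),
      (p 0 ^ 2 - 1) / (4 * p 0 ^ 2) * ((p 1 ^ 2 - 1) / (4 * p 1 ^ 2)) * p 2], _, ?_, ?_, ?_, rfl,
    wedge_two_isogeny hp₀ hp₁⟩
  · rw [div_mul_div_comm]
    exact div_ne_zero (by simpa [evalFamily] using hnum) (by simp [hp₀, hp₁])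
  · intro i
    fin_cases i <;>
      simp [evalFamily, isogenousToKumDen, isogenousToKumNum, hp₀, hp₁]
    field_simp
    norm_num
  · have hmem := onDoublePlane_kumBranch_isogenousCurve.1 hp.mem
    simp only [onDoublePlane_kumBranch_legendreCurve, Matrix.cons_val,
      legendre_cubic_isogeny hp₀, legendre_cubic_isogeny hp₁, mul_pow, hmem, map_one, map_pow,
      map_ofNat]
    ring

lemma kumToPencil_apply {a b w₁ w₂ u : F} (ha : a = algebraMap K F κ₁ ^ 2)
    (hb : b = algebraMap K F κ₂ ^ 2) (he₁ : 1 - a ≠ 0) (he₂ : 1 - b ≠ 0)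
    (hw₁ : w₁ = 1 - (1 - a) * p 0) (hw₂ : w₂ = 1 - (1 - b) * p 1) (hu : u = w₁ / w₂)
    (hp₀ : p 0 ≠ 0) (hw₁0 : w₁ ≠ 0) (hw₂0 : w₂ ≠ 0) (i : Fin 3) :
    evalFamily κ₁ κ₂ p (kumToPencilDen i) ≠ 0 ∧
      evalFamily κ₁ κ₂ p (kumToPencilNum i) / evalFamily κ₁ κ₂ p (kumToPencilDen i) =
        ![p 1 / p 0 * (1 - b * u) / (1 - a), (u - a) * (1 - b * u) / ((1 - a) * (1 - b) * u),
          (b * u ^ 2 - a) * (1 - b * u) * (u - 1) /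
            ((1 - a) ^ 2 * (1 - b) * u ^ 2 * p 0 ^ 2 * w₂) * p 2] i := by
  rw [hu]
  fin_cases i <;>
    simp [evalFamily, kumToPencilDen, kumToPencilNum, kumToPencilJacobian, he₁, he₂, hp₀, hw₁0,
      hw₂0, ← ha, ← hb, ← hw₁, ← hw₂, -sub_sub_sub_cancel_left] <;>
    field_simp

lemma preservesForm_kumToPencil (hκ₁ : κ₁ ≠ 0) (hΛ₁ : Λ₁ * (1 - κ₁ ^ 2) = 1)
    (hΛ₂ : Λ₂ * (1 - κ₂ ^ 2) = 1) (hρ₁ : ρ₁ = Λ₁ + Λ₂ - 2 * Λ₁ * Λ₂ - 1)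
    (hρ₂ : ρ₂ ^ 2 = (1 - Λ₁ - Λ₂) ^ 2)
    (hp : IsDoublePlaneField (kumBranch (legendreCurve Λ₁) (legendreCurve Λ₂) 1) p) :
    PreservesForm κ₁ κ₂ kumToPencilNum kumToPencilDen (pencilBranch ρ₁ ρ₂) p := by
  have hden : evalFamily κ₁ κ₂ ![p 0, p 1, 0]
      (X 2 * (1 - (1 - X 0 ^ 2) * X 2) * (1 - (1 - X 1 ^ 2) * X 3)) ≠ 0 :=
    evalFamily_ne_zero_of_algebraicIndependent hp.indep 1 0 (by simp [evalFamily, hκ₁])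
  have hjac : evalFamily κ₁ κ₂ ![p 0, p 1, 0] kumToPencilJacobian ≠ 0 :=
    evalFamily_ne_zero_of_algebraicIndependent hp.indep (1 - κ₁ ^ 2)⁻¹ 0
      (by simp [evalFamily, hκ₁, right_ne_zero_of_mul_eq_one hΛ₁, kumToPencilJacobian])
  set a := algebraMap K F κ₁ ^ 2 with ha
  set b := algebraMap K F κ₂ ^ 2 with hb
  have hl₁ : algebraMap K F Λ₁ * (1 - a) = 1 := by simpa using congrArg (algebraMap K F) hΛ₁
  have hl₂ : algebraMap K F Λ₂ * (1 - b) = 1 := by simpa using congrArg (algebraMap K F) hΛ₂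
  have he₁ : 1 - a ≠ 0 := right_ne_zero_of_mul_eq_one hl₁
  have he₂ : 1 - b ≠ 0 := right_ne_zero_of_mul_eq_one hl₂
  obtain ⟨w₁, hw₁⟩ : ∃ w, w = 1 - (1 - a) * p 0 := ⟨_, rfl⟩
  obtain ⟨w₂, hw₂⟩ : ∃ w, w = 1 - (1 - b) * p 1 := ⟨_, rfl⟩
  obtain ⟨⟨hp₀, hw₁0⟩, hw₂0⟩ : (p 0 ≠ 0 ∧ w₁ ≠ 0) ∧ w₂ ≠ 0 := by
    simpa [evalFamily, hw₁, hw₂] using hden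
  have hnum : (b * w₁ ^ 2 - a * w₂ ^ 2) * (w₂ - b * w₁) * (w₁ - w₂) ≠ 0 := by
    simpa [evalFamily, kumToPencilJacobian, hw₁, hw₂] using hjac
  refine ⟨_, _, ?_, kumToPencil_apply ha hb he₁ he₂ hw₁ hw₂ rfl hp₀ hw₁0 hw₂0, ?_, rfl,
    wedge_pencil_of_kum (by simp [ha]) (by simp [hb]) he₁ he₂ hw₁ hw₂ rfl hp₀ hw₁0 hw₂0⟩
  · convert div_ne_zero hnum (show (1 - a) ^ 2 * (1 - b) * p 0 ^ 2 * w₁ ^ 2 * w₂ ^ 3 ≠ 0 by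
      simp [he₁, he₂, hp₀, hw₁0, hw₂0]) using 1
    field_simp
  · have hmem := onDoublePlane_kumBranch_legendreCurve.1 hp.mem
    rw [legendre_cubic_eq hl₁, legendre_cubic_eq hl₂, map_one, one_mul, ← hw₁, ← hw₂] at hmem
    simp only [onDoublePlane_pencilBranch, Matrix.cons_val]
    rw [mul_pow, hmem, pencil_quadratic_eq hl₁ hl₂ (by simp [hρ₁, map_ofNat])
      (by simpa using congrArg (algebraMap K F) hρ₂)]
    exact pencil_equation_of_kum he₁ he₂ hw₁ hw₂ rfl hp₀ hw₁0 hw₂0 rfl rfl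

lemma evalFamily_pencilMobiusNum {a k c s : F} (ha : a = algebraMap K F κ₁ ^ 2)
    (hk : k = algebraMap K F κ₂) (hc : c = (1 - a) * (1 - k ^ 2) * p 1 - (1 + a * k ^ 2))
    (hv : p 0 - p 1 ≠ 0) (hs : s = p 0 * (p 0 - 1) / (p 0 - p 1)) :
    evalFamily κ₁ κ₂ p pencilMobiusNum =
      (p 0 - p 1) * ((1 + k) * (c + k * (1 + a)) * s - k * (1 - k) * (1 - a)) := by
  rw [hs]
  simp only [evalFamily, pencilMobiusNum, eval₂_add, eval₂_sub, eval₂_mul, eval₂_pow, eval₂_X,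
    eval₂_one, Matrix.cons_val, ← hk, ← ha, ← hc]
  field_simp
  ring

lemma evalFamily_pencilMobiusDen {a k c s : F} (ha : a = algebraMap K F κ₁ ^ 2)
    (hk : k = algebraMap K F κ₂) (hc : c = (1 - a) * (1 - k ^ 2) * p 1 - (1 + a * k ^ 2))
    (hv : p 0 - p 1 ≠ 0) (hs : s = p 0 * (p 0 - 1) / (p 0 - p 1)) :
    evalFamily κ₁ κ₂ p pencilMobiusDen =
      (p 0 - p 1) * (k * (1 + k) * (1 - a) * s + (1 - k) * (c - k * (1 + a))) := by
  rw [hs]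
  simp only [evalFamily, pencilMobiusDen, eval₂_add, eval₂_sub, eval₂_mul, eval₂_pow, eval₂_X,
    eval₂_one, Matrix.cons_val, ← hk, ← ha, ← hc]
  field_simp
  ring

lemma evalFamily_pencilQuadratic {a k s : F} (ha : a = algebraMap K F κ₁ ^ 2)
    (hk : k = algebraMap K F κ₂) (hv : p 0 - p 1 ≠ 0)
    (hs : s = p 0 * (p 0 - 1) / (p 0 - p 1)) :
    evalFamily κ₁ κ₂ p pencilQuadratic = (p 0 - p 1) ^ 2 *
      ((1 - a) * (1 + k) ^ 2 * s ^ 2 - 2 * (1 + a) * (1 - k ^ 2) * s + (1 - a) * (1 - k) ^ 2) := by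
  rw [hs]
  simp only [evalFamily, pencilQuadratic, eval₂_add, eval₂_sub, eval₂_mul, eval₂_pow, eval₂_X,
    eval₂_one, eval₂_ofNat, Matrix.cons_val, ← hk, ← ha]
  field_simp
  ring

lemma pencilToIsogenous_apply {a k s N D g : F} (ha : a = algebraMap K F κ₁ ^ 2)
    (hk : k = algebraMap K F κ₂) (hv : p 0 - p 1 ≠ 0) (hs : s = p 0 * (p 0 - 1) / (p 0 - p 1))
    (hN : evalFamily κ₁ κ₂ p pencilMobiusNum = (p 0 - p 1) * N)
    (hD : evalFamily κ₁ κ₂ p pencilMobiusDen = (p 0 - p 1) * D)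
    (hg : evalFamily κ₁ κ₂ p pencilQuadratic = (p 0 - p 1) ^ 2 * g)
    (hN0 : N ≠ 0) (hD0 : D ≠ 0) (i : Fin 3) :
    evalFamily κ₁ κ₂ p (pencilToIsogenousDen i) ≠ 0 ∧
      evalFamily κ₁ κ₂ p (pencilToIsogenousNum i) / evalFamily κ₁ κ₂ p (pencilToIsogenousDen i) =
        ![N / D, s * D / N, -(k * (1 - a) * (1 - k ^ 2) * g / (N * D)) *
          ((p 0 ^ 2 - 2 * p 1 * p 0 + p 1) / (p 0 - p 1) ^ 2) * p 2] i := by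
  simp only [evalFamily, ← hk] at hN hD hg
  fin_cases i <;>
    simp [evalFamily, pencilToIsogenousDen, pencilToIsogenousNum, hN, hD, hg, hs, hv, hN0, hD0,
      ← ha, ← hk] <;>
    field_simp

lemma pencilToIsogenous_factors_ne_zero (hκ₂ : κ₂ ≠ 0) (he₁ : 1 - κ₁ ^ 2 ≠ 0) (he₂ : 1 - κ₂ ^ 2 ≠ 0)
    (hp : AlgebraicIndependent K ![p 0, p 1]) :
    p 0 - p 1 ≠ 0 ∧ evalFamily κ₁ κ₂ p pencilMobiusNum ≠ 0 ∧
      evalFamily κ₁ κ₂ p pencilMobiusDen ≠ 0 ∧ evalFamily κ₁ κ₂ p pencilQuadratic ≠ 0 ∧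
      p 0 ^ 2 - 2 * p 1 * p 0 + p 1 ≠ 0 := by
  obtain ⟨hsub, hadd⟩ : κ₂ - 1 ≠ 0 ∧ 1 + κ₂ ≠ 0 := by
    rw [← mul_ne_zero_iff, show (κ₂ - 1) * (1 + κ₂) = -(1 - κ₂ ^ 2) by ring]
    exact neg_ne_zero.2 he₂
  have hnum : evalFamily κ₁ κ₂ ![p 0, p 1, 0] pencilMobiusNum ≠ 0 :=
    evalFamily_ne_zero_of_algebraicIndependent hp 0 1
      (by simp [evalFamily, pencilMobiusNum, hκ₂, he₁, hsub])
  have hden : evalFamily κ₁ κ₂ ![p 0, p 1, 0] pencilMobiusDen ≠ 0 :=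
    evalFamily_ne_zero_of_algebraicIndependent hp 2 2
      (by simp [evalFamily, pencilMobiusDen, hκ₂, he₁, hadd, sub_ne_zero])
  have hquad : evalFamily κ₁ κ₂ ![p 0, p 1, 0] pencilQuadratic ≠ 0 :=
    evalFamily_ne_zero_of_algebraicIndependent hp 0 1
      (by simp [evalFamily, pencilQuadratic, he₁, hsub])
  have hfibre : evalFamily κ₁ κ₂ ![p 0, p 1, 0]
      ((X 2 - X 3) * (X 2 ^ 2 - 2 * X 3 * X 2 + X 3)) ≠ 0 :=
    evalFamily_ne_zero_of_algebraicIndependent hp 0 1 (by simp [evalFamily])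
  obtain ⟨hv, hM⟩ : p 0 - p 1 ≠ 0 ∧ p 0 ^ 2 - 2 * p 1 * p 0 + p 1 ≠ 0 := by
    simpa [evalFamily] using hfibre
  exact ⟨hv, by simpa [evalFamily, pencilMobiusNum] using hnum,
    by simpa [evalFamily, pencilMobiusDen] using hden,
    by simpa [evalFamily, pencilQuadratic] using hquad, hM⟩

lemma preservesForm_pencilToIsogenous (hκ₂ : κ₂ ≠ 0) (hΛ₁ : Λ₁ * (1 - κ₁ ^ 2) = 1)
    (hΛ₂ : Λ₂ * (1 - κ₂ ^ 2) = 1) (hρ₁ : ρ₁ = Λ₁ + Λ₂ - 2 * Λ₁ * Λ₂ - 1)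
    (hρ₂ : ρ₂ ^ 2 = (1 - Λ₁ - Λ₂) ^ 2) (hp : IsDoublePlaneField (pencilBranch ρ₁ ρ₂) p) :
    PreservesForm κ₁ κ₂ pencilToIsogenousNum pencilToIsogenousDen
      (kumBranch (isogenousCurve Λ₁) (isogenousCurve Λ₂) 1) p := by
  obtain ⟨hv, hnum, hden, hquad, hM⟩ := pencilToIsogenous_factors_ne_zero hκ₂
    (right_ne_zero_of_mul_eq_one hΛ₁) (right_ne_zero_of_mul_eq_one hΛ₂) hp.indep
  obtain ⟨a, ha⟩ : ∃ a, a = algebraMap K F κ₁ ^ 2 := ⟨_, rfl⟩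
  obtain ⟨k, hk⟩ : ∃ k, k = algebraMap K F κ₂ := ⟨_, rfl⟩
  obtain ⟨c, hc⟩ : ∃ c, c = (1 - a) * (1 - k ^ 2) * p 1 - (1 + a * k ^ 2) := ⟨_, rfl⟩
  obtain ⟨s, hs⟩ : ∃ s, s = p 0 * (p 0 - 1) / (p 0 - p 1) := ⟨_, rfl⟩
  have hN := evalFamily_pencilMobiusNum ha hk hc hv hs
  have hD := evalFamily_pencilMobiusDen ha hk hc hv hs
  have hg := evalFamily_pencilQuadratic ha hk hv hs
  have hN0 := right_ne_zero_of_mul (hN ▸ hnum)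
  have hD0 := right_ne_zero_of_mul (hD ▸ hden)
  have hg0 := right_ne_zero_of_mul (hg ▸ hquad)
  have hl₁ : algebraMap K F Λ₁ * (1 - a) = 1 := by simpa [ha] using congrArg (algebraMap K F) hΛ₁
  have hl₂ : algebraMap K F Λ₂ * (1 - k ^ 2) = 1 := by
    simpa [hk] using congrArg (algebraMap K F) hΛ₂
  have he₁ : 1 - a ≠ 0 := right_ne_zero_of_mul_eq_one hl₁
  have he₂ : 1 - k ^ 2 ≠ 0 := right_ne_zero_of_mul_eq_one hl₂
  have hk0 : k ≠ 0 := by simpa [hk] using hκ₂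
  refine ⟨_, _, ?_, pencilToIsogenous_apply ha hk hv hs hN hD hg hN0 hD0, ?_, rfl, ?_⟩
  · simp [hk0, he₁, he₂, hg0, hN0, hD0, hM, hv]
  · have hmem := hp.mem
    rw [onDoublePlane_pencilBranch] at hmem
    simp only [onDoublePlane_kumBranch_isogenousCurve, Matrix.cons_val, map_one, one_mul]
    rw [isogenous_equation hl₁ hl₂ hc rfl rfl rfl hN0 hD0, mul_pow, hmem,
      pencil_quadratic_eq hl₁ hl₂ (by simp [hρ₁, map_ofNat])
      (by simpa using congrArg (algebraMap K F) hρ₂), ← hc, hs, pencil_fibre_isogeny hv]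
    field_simp
  · simp only [Matrix.cons_val]
    rw [wedge_isogenous_of_fibre (by simp [ha]) (by simp [hk]) hc rfl rfl rfl hN0 hD0, hs,
      wedge_pencil_fibre hv, smul_smul]

end Maps

end

end KummerSandwich

theorem mainTheorem7 :
    ∃ N₁ D₁ N₂ D₂ N₃ D₃ : Fin 3 → MvPolynomial (Fin 5) ℚ,
      ∀ (K : Type u) [Field K] [CharZero K] (κ₁ κ₂ Λ₁ Λ₂ ρ₁ ρ₂ : K),
        Λ₁ = 1 / (1 - κ₁ ^ 2) → Λ₂ = 1 / (1 - κ₂ ^ 2) →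
        Λ₁ ≠ 0 → Λ₁ ≠ 1 → Λ₂ ≠ 0 → Λ₂ ≠ 1 →
        ρ₁ = Λ₁ + Λ₂ - 2 * Λ₁ * Λ₂ - 1 → ρ₂ ^ 2 = (1 - Λ₁ - Λ₂) ^ 2 →
        ∀ (S : KummerSandwich.Kum (KummerSandwich.legendreCurve Λ₁)
              (KummerSandwich.legendreCurve Λ₂) 1)
          (X : KummerSandwich.LegendreK3 ρ₁ ρ₂)
          (S' : KummerSandwich.Kum (KummerSandwich.isogenousCurve Λ₁)
              (KummerSandwich.isogenousCurve Λ₂) 1)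
          (St : KummerSandwich.Kum (KummerSandwich.legendreCurve Λ₁)
              (KummerSandwich.legendreCurve Λ₂) (2 ^ 4)),
          ∃ (f₁ : KummerSandwich.DominantMap S X) (f₂ : KummerSandwich.DominantMap X S')
            (f₃ : KummerSandwich.DominantMap S' St),
            f₁.GivenBy κ₁ κ₂ (KummerSandwich.Kum.coords S) (KummerSandwich.LegendreK3.coords X)
              N₁ D₁ ∧
            f₂.GivenBy κ₁ κ₂ (KummerSandwich.LegendreK3.coords X) (KummerSandwich.Kum.coords S')
              N₂ D₂ ∧
            f₃.GivenBy κ₁ κ₂ (KummerSandwich.Kum.coords S') (KummerSandwich.Kum.coords St)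
              N₃ D₃ ∧
            f₁.pullback (KummerSandwich.LegendreK3.form X) = KummerSandwich.Kum.form S ∧
            f₂.pullback (KummerSandwich.Kum.form S') = KummerSandwich.LegendreK3.form X ∧
            f₃.pullback (KummerSandwich.Kum.form St) = KummerSandwich.Kum.form S' := by
  open KummerSandwich in
  refine ⟨kumToPencilNum, kumToPencilDen, pencilToIsogenousNum, pencilToIsogenousDen,
    isogenousToKumNum, isogenousToKumDen, ?_⟩
  intro K _ _ κ₁ κ₂ Λ₁ Λ₂ ρ₁ ρ₂ hΛ₁ hΛ₂ h₁0 h₁1 h₂0 h₂1 hρ₁ hρ₂ S X₀ S' St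
  have hmul : ∀ {κ Λ : K}, Λ = 1 / (1 - κ ^ 2) → Λ ≠ 0 → Λ * (1 - κ ^ 2) = 1 := by
    rintro κ Λ rfl h
    exact one_div_mul_cancel fun h0 => h (by rw [h0, div_zero])
  have hκ : ∀ {κ Λ : K}, Λ = 1 / (1 - κ ^ 2) → Λ ≠ 1 → κ ≠ 0 := by
    rintro κ Λ rfl h rfl
    exact h (by simp)
  have hS := Kum.isDoublePlaneField one_ne_zero S
  have hX := LegendreK3.isDoublePlaneField X₀
  have hS' := Kum.isDoublePlaneField one_ne_zero S'
  have hSt := Kum.isDoublePlaneField (pow_ne_zero 4 two_ne_zero) St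
  obtain ⟨f₁, hf₁, hω₁⟩ := exists_dominantMap_of_preservesForm hS hX
    (preservesForm_kumToPencil (hκ hΛ₁ h₁1) (hmul hΛ₁ h₁0) (hmul hΛ₂ h₂0) hρ₁ hρ₂ hS)
  obtain ⟨f₂, hf₂, hω₂⟩ := exists_dominantMap_of_preservesForm hX hS'
    (preservesForm_pencilToIsogenous (hκ hΛ₂ h₂1) (hmul hΛ₁ h₁0) (hmul hΛ₂ h₂0) hρ₁ hρ₂ hX)
  obtain ⟨f₃, hf₃, hω₃⟩ := exists_dominantMap_of_preservesForm hS' hSt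
    (preservesForm_isogenousToKum hS')
  exact ⟨f₁, f₂, f₃, hf₁, hf₂, hf₃, hω₁, hω₂, hω₃⟩
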